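/- Let $(W,S)$ be a right-angled Coxeter system, i.e. $W$ is the group generated by the set $S$ subject to the relations $(st)^{m(s,t)}=1$ with $m(s,s)=1$ and $m(s,t)=m(t,s)\in\{2,\infty\}$ for $s\neq t$ (no relation if $m(s,t)=\infty$). Let $|w|$ be the word length of $w\in W$. Let $q>0$ and $p=(q-1)/\sqrt q$. For $s\in S$ let $T_s$ be the bounded operator on $\ell^2(W)$ with $T_s\delta_w=\delta_{sw}$ if $|sw|>|w|$ and $T_s\delta_w=\delta_{sw}+p\,\delta_w$ otherwise, and for $w\in W$ with reduced expression $w=w_1\cdots w_n$ put $T_w=T_{w_1}\cdots T_{w_n}$, so that $T_w\delta_e=\delta_w$. Let $\mathcal M_q$ be the von Neumann algebra generated by $\{T_s: s\in S\}$ (the Hecke von Neumann algebra of $(W,S)$), let $\tau(x)=\langle x\Omega,\Omega\rangle$ with $\Omega=\delta_e$, and for $s\in S$ let $\mathcal M_q(s)\subseteq\mathcal M_q$ be the von Neumann subalgebra generated by $T_s$. Then for every $0<r<1$ there is a normal (i.e. $\sigma$-weakly continuous) unital completely positive map $\Phi_r:\mathcal M_q\to\mathcal M_q$ with $$\Phi_r(T_w)=r^{|w|}T_w\qquad\text{for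 all } w\in W,$$ and $\Phi_r$ is the only normal linear map on $\mathcal M_q$ with these values. Moreover, each $\mathcal M_q(s)$ is two-dimensional, and $(\mathcal M_q,\tau)$ is the graph product of the algebras $(\mathcal M_q(s),\tau|_{\mathcal M_q(s)})$, $s\in S$, over the graph on $S$ in which $s\ne t$ are joined by an edge if and only if $m(s,t)=2$. That is: $\Omega$ is a cyclic unit vector, the algebras $\mathcal M_q(s)$ generate $\mathcal M_q$, the restrictions of $\tau$ to them are GNS-faithful, $\mathcal M_q(s)$ and $\mathcal M_q(t)$ commute whenever $s\neq t$ and $m(s,t)=2$, and $\tau(a_1\cdots a_n)=0$ whenever $s_1\cdots s_n$ is a non-empty reduced word and $a_i\in\mathcal M_q(s_i)$ with $\tau(a_i)=0$. Finally, $\Phi_r$ is the graph product of the $\tau$-preserving unital completely positive maps $\varphi_s:\mathcal M_q(s)\to\mathcal M_q(s)$ given by $\varphi_s(1)=1$, $\varphi_s(T_s)=rT_s$. That is, $\Phi_r(a_1\cdots a_n)=\varphi_{s_1}(a_1)\cdots\varphi_{s_n}(a_n)$ whenever $s_1\cdots s_n$ is a reduced word and $a_i\in\mathcal M_q(s_i)$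 with $\tau(a_i)=0$. -/

import Mathlib

open scoped ENNReal CStarAlgebra InnerProductSpace

noncomputable section

/-! ### Von Neumann algebras: C⋆-structure, generation, normal maps -/

namespace VonNeumannAlgebra

variable {H : Type*} [NormedAddCommGroup H] [InnerProductSpace ℂ H] [CompleteSpace H]

instance instSMulMemClassComplex : SMulMemClass (VonNeumannAlgebra H) ℂ (H →L[ℂ] H) where
  smul_mem {N} c _ hx := N.toStarSubalgebra.smul_mem hx c

instance instIsClosedCoe (N : VonNeumannAlgebra H) : IsClosed (N : Set (H →L[ℂ] H)) := by
  rw [← N.centralizer_centralizer]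
  exact Set.isClosed_centralizer _

/-- The order on a von Neumann algebra is the restriction of the Loewner order on the bounded
operators. -/
instance instStarOrderedRingCoe (N : VonNeumannAlgebra H) : StarOrderedRing N := by
  refine StarOrderedRing.of_nonneg_iff' ?_ ?_
  · intro x y hxy z
    exact add_le_add_right (show (x : H →L[ℂ] H) ≤ y from hxy) (z : H →L[ℂ] H)
  · intro x
    constructor
    · intro hx
      have hx' : (0 : H →L[ℂ] H) ≤ x := hx
      have hmem : CFC.sqrt (x : H →L[ℂ] H) ∈ N := by
        rw [← SetLike.mem_coe, ← N.centralizer_centralizer]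
        intro y hy
        have hc : Commute (x : H →L[ℂ] H) y := hy _ x.2
        exact (hc.cfcₙ_nnreal NNReal.sqrt).symm
      refine ⟨⟨_, hmem⟩, Subtype.ext ?_⟩
      have hsa : star (CFC.sqrt (x : H →L[ℂ] H)) = CFC.sqrt (x : H →L[ℂ] H) :=
        (CFC.sqrt_nonneg (x : H →L[ℂ] H)).isSelfAdjoint.star_eq
      show (x : H →L[ℂ] H) = star (CFC.sqrt (x : H →L[ℂ] H)) * CFC.sqrt (x : H →L[ℂ] H)
      rw [hsa, CFC.sqrt_mul_sqrt_self _ hx']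
    · rintro ⟨s, rfl⟩
      exact star_mul_self_nonneg (s : H →L[ℂ] H)

/-- The von Neumann algebra generated by a set of operators: the bicommutant of the set together
with the adjoints of its elements. -/
def generatedBy (X : Set (H →L[ℂ] H)) : VonNeumannAlgebra H where
  toStarSubalgebra := StarSubalgebra.centralizer ℂ
    (StarSubalgebra.centralizer ℂ X : Set (H →L[ℂ] H))
  centralizer_centralizer' := by
    simp [StarSubalgebra.coe_centralizer]

end VonNeumannAlgebra

namespace VonNeumannAlgebra

variable {H : Type*} [NormedAddCommGroup H] [InnerProductSpace ℂ H] [CompleteSpace H]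

/-- The `σ`-weak (ultraweak) topology: the coarsest topology that makes all functionals
`x ↦ ∑ₙ ⟨x ξₙ, ηₙ⟩` with `∑ₙ ‖ξₙ‖² < ∞` and `∑ₙ ‖ηₙ‖² < ∞` continuous. -/
@[reducible] def ultraweakTopology (N : VonNeumannAlgebra H) : TopologicalSpace N :=
  ⨅ (ξ : ℕ → H) (η : ℕ → H) (_ : Summable fun n => ‖ξ n‖ ^ 2) (_ : Summable fun n => ‖η n‖ ^ 2),
    TopologicalSpace.induced
      (fun x : N => ∑' n, ⟪η n, (x : H →L[ℂ] H) (ξ n)⟫_ℂ) inferInstance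

/-- A linear map between von Neumann algebras is normal if it is `σ`-weakly continuous. -/
def IsNormalMap (N₁ N₂ : VonNeumannAlgebra H) (Φ : N₁ →ₗ[ℂ] N₂) : Prop :=
  @Continuous N₁ N₂ N₁.ultraweakTopology N₂.ultraweakTopology Φ

end VonNeumannAlgebra

/-! ### Right-angled Coxeter systems and Hecke operators -/

/-- Right-angled: `m(s,t) ∈ {2, ∞}` for `s ≠ t`. The value `0` of a Coxeter matrix encodes `∞`. -/
def CoxeterMatrix.IsRightAngled {B : Type*} (M : CoxeterMatrix B) : Prop :=
  ∀ s t : B, s ≠ t → M s t = 2 ∨ M s t = 0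

/-- The Hilbert space `ℓ²(W)`. -/
abbrev EllTwo (W : Type*) : Type _ := lp (fun _ : W => ℂ) 2

namespace EllTwo

variable {W : Type*}

open scoped Classical in
/-- The standard basis vectors. -/
def delta (w : W) : EllTwo W := lp.single 2 w (1 : ℂ)

/-- Left translation `δ_w ↦ δ_{gw}`. -/
def translate [Group W] (g : W) : EllTwo W →ₗᵢ[ℂ] EllTwo W where
  toFun f := ⟨fun w => f (g⁻¹ * w), by
    have hf := (memℓp_gen_iff (by norm_num : 0 < (2 : ℝ≥0∞).toReal)).1 (lp.memℓp f)
    exact (memℓp_gen_iff (by norm_num : 0 < (2 : ℝ≥0∞).toReal)).2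
      ((Equiv.mulLeft g⁻¹).summable_iff.2 hf)⟩
  map_add' _ _ := rfl
  map_smul' _ _ := rfl
  norm_map' f := by
    have h2 : 0 < (2 : ℝ≥0∞).toReal := by norm_num
    rw [lp.norm_eq_tsum_rpow h2, lp.norm_eq_tsum_rpow h2]
    congr 1
    exact (Equiv.mulLeft g⁻¹).tsum_eq fun w => ‖f w‖ ^ (2 : ℝ≥0∞).toReal

/-- The orthogonal projection onto the closed span of the `δ_w`, `w ∈ A`. -/
def restrict (A : Set W) : EllTwo W →L[ℂ] EllTwo W :=
  LinearMap.mkContinuous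
    { toFun := fun f => ⟨A.indicator f, by
        refine (lp.memℓp f).mono' fun w => ?_
        exact norm_indicator_le_norm_self _ _⟩
      map_add' := fun f g => by
        ext w
        exact congrFun (Set.indicator_add A (f : W → ℂ) g) w
      map_smul' := fun c f => by
        ext w
        exact congrFun (Set.indicator_const_smul A c (f : W → ℂ)) w } 1
    (fun f => by
      have h2 : 0 < (2 : ℝ≥0∞).toReal := by norm_num
      rw [one_mul]
      refine lp.norm_le_of_tsum_le h2 (norm_nonneg _) ?_
      rw [lp.norm_rpow_eq_tsum h2]
      have hs := (memℓp_gen_iff h2).1 (lp.memℓp f)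
      have hle : ∀ w, ‖A.indicator (f : W → ℂ) w‖ ^ (2 : ℝ≥0∞).toReal
          ≤ ‖f w‖ ^ (2 : ℝ≥0∞).toReal := fun w =>
        Real.rpow_le_rpow (norm_nonneg _) (norm_indicator_le_norm_self _ _) h2.le
      exact Summable.tsum_le_tsum hle
        (Summable.of_nonneg_of_le (fun w => by positivity) hle hs) hs)

end EllTwo

namespace CoxeterSystem

variable {B W : Type*} [Group W] {M : CoxeterMatrix B} (cs : CoxeterSystem M W) (q : ℝ)

/-- The operator `T_s` on `L²(M_q)`. The space `L²(M_q)`, with its orthonormal basis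
`(T_w Ω)_{w ∈ W}`, is realised as `ℓ²(W)` with its standard basis `(δ_w)_{w ∈ W}`; then `T_s` is
given by `T_s δ_w = δ_{sw}` if `|sw| > |w|` and `T_s δ_w = δ_{sw} + p δ_w` otherwise, where
`p = (q - 1) / √q`; see `heckeOp_delta`. -/
def heckeOp (s : B) : EllTwo W →L[ℂ] EllTwo W :=
  (EllTwo.translate (cs.simple s)).toContinuousLinearMap +
    (((q - 1) / √q : ℝ) : ℂ) • EllTwo.restrict {w | cs.IsLeftDescent w s}

open scoped Classical in
theorem heckeOp_delta (s : B) (w : W) :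
    cs.heckeOp q s (EllTwo.delta w) =
      if cs.length w < cs.length (cs.simple s * w) then EllTwo.delta (cs.simple s * w)
      else EllTwo.delta (cs.simple s * w) + (((q - 1) / √q : ℝ) : ℂ) • EllTwo.delta w := by
  have h1 : EllTwo.translate (cs.simple s) (EllTwo.delta w)
      = EllTwo.delta (cs.simple s * w) := by
    ext v
    change (lp.single 2 w (1 : ℂ) : EllTwo W) ((cs.simple s)⁻¹ * v)
      = (lp.single 2 (cs.simple s * w) (1 : ℂ) : EllTwo W) v
    simp only [lp.single_apply, Pi.single_apply, inv_mul_eq_iff_eq_mul]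
  have h2 : EllTwo.restrict {w | cs.IsLeftDescent w s} (EllTwo.delta w)
      = if cs.IsLeftDescent w s then EllTwo.delta w else 0 := by
    ext v
    simp only [EllTwo.restrict, LinearMap.mkContinuous_apply, LinearMap.coe_mk, AddHom.coe_mk,
      Set.indicator_apply, Set.mem_ofPred_eq]
    by_cases hv : v = w
    · subst hv
      split_ifs <;> simp
    · have h0 : (EllTwo.delta w : EllTwo W) v = 0 := by
        simp [EllTwo.delta, lp.single_apply, hv]
      split_ifs <;> simp [h0]
  have h3 : cs.length w < cs.length (cs.simple s * w) ↔ ¬ cs.IsLeftDescent w s := by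
    have := cs.length_simple_mul_ne w s
    unfold IsLeftDescent
    omega
  simp only [heckeOp, add_apply, smul_apply,
    LinearIsometry.coe_toContinuousLinearMap, h1, h2, h3]
  by_cases hd : cs.IsLeftDescent w s <;> simp [hd]

/-- The Hecke von Neumann algebra `M_q`. -/
def heckeVN : VonNeumannAlgebra (EllTwo W) :=
  VonNeumannAlgebra.generatedBy (Set.range (cs.heckeOp q))

theorem heckeOp_mem_generatedBy (X : Set B) {s : B} (hs : s ∈ X) :
    cs.heckeOp q s ∈ VonNeumannAlgebra.generatedBy (cs.heckeOp q '' X) := by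
  change cs.heckeOp q s ∈ StarSubalgebra.centralizer ℂ _
  rw [StarSubalgebra.mem_centralizer_iff]
  intro y hy
  have h := (StarSubalgebra.mem_centralizer_iff ℂ).1 hy _ ⟨s, hs, rfl⟩
  refine ⟨h.1.symm, ?_⟩
  have h' := congrArg star h.2
  rw [star_mul, star_mul, star_star] at h'
  exact h'

/-- `T_s` as an element of `M_q`. -/
def heckeT (s : B) : cs.heckeVN q :=
  ⟨cs.heckeOp q s, by
    have h := cs.heckeOp_mem_generatedBy q Set.univ (Set.mem_univ s)
    rwa [Set.image_univ] at h⟩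

/-- `T_w = T_{w₁} ⋯ T_{wₙ} ∈ M_q` for a fixed choice of a reduced expression
`w = w₁ ⋯ wₙ`. -/
def heckeTw (w : W) : cs.heckeVN q :=
  ((cs.exists_isReduced w).choose.map (cs.heckeT q)).prod

theorem heckeT_prod_delta_one (ω : List B) (hω : cs.IsReduced ω) :
    ((ω.map (cs.heckeT q)).prod : EllTwo W →L[ℂ] EllTwo W) (EllTwo.delta 1)
      = EllTwo.delta (cs.wordProd ω) := by
  induction ω with
  | nil => simp
  | cons s ω ih =>
    have hω' : cs.IsReduced ω := by simpa using hω.drop 1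
    have hlt : cs.length (cs.wordProd ω) < cs.length (cs.simple s * cs.wordProd ω) := by
      rw [← cs.wordProd_cons, hω.eq, hω'.eq]
      simp
    change cs.heckeOp q s (((ω.map (cs.heckeT q)).prod : EllTwo W →L[ℂ] EllTwo W)
      (EllTwo.delta 1)) = _
    rw [ih hω', heckeOp_delta, if_pos hlt, cs.wordProd_cons]

/-- `T_w Ω = δ_w`, where `Ω = T_e = δ_e`. -/
theorem heckeTw_delta_one (w : W) :
    (cs.heckeTw q w : EllTwo W →L[ℂ] EllTwo W) (EllTwo.delta 1) = EllTwo.delta w := by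
  have h := (cs.exists_isReduced w).choose_spec
  conv_rhs => rw [h.2]
  exact cs.heckeT_prod_delta_one q _ h.1

/-- The vertex algebra `M_q(s) ⊆ M_q`, generated by `T_s`. -/
def vertexVN (s : B) : VonNeumannAlgebra (EllTwo W) :=
  VonNeumannAlgebra.generatedBy (cs.heckeOp q '' {s})

/-- `T_s` as an element of `M_q(s)`. -/
def vertexT (s : B) : cs.vertexVN q s :=
  ⟨cs.heckeOp q s, cs.heckeOp_mem_generatedBy q {s} rfl⟩

/-! ### Graph products -/

section GraphProduct

variable {H : Type*} [NormedAddCommGroup H] [InnerProductSpace ℂ H] [CompleteSpace H]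

/-- `N`, with the vector state `τ = ⟨· Ω, Ω⟩`, is the (internal) graph product of its
subalgebras `P s` over the graph on `B` in which `s ≠ t` are joined by an edge iff
`m(s,t) = 2`. -/
structure IsGraphProduct (N : VonNeumannAlgebra H) (Ω : H) (P : B → VonNeumannAlgebra H) :
    Prop where
  norm_eq_one : ‖Ω‖ = 1
  /-- `H` is the GNS space of `(N, τ)`, with cyclic vector `Ω`. -/
  cyclic : Dense (Set.range fun x : N => (x : H →L[ℂ] H) Ω)
  /-- The restriction of `τ` to each vertex algebra is GNS faithful. -/
  faithful : ∀ (s : B), ∀ x ∈ P s,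
    (∀ y ∈ P s, ∀ z ∈ P s, ⟪Ω, (y * x * z) Ω⟫_ℂ = 0) → x = 0
  generated : VonNeumannAlgebra.generatedBy (⋃ s, (P s : Set (H →L[ℂ] H))) = N
  commute : ∀ s t : B, s ≠ t → M s t = 2 → ∀ x ∈ P s, ∀ y ∈ P t, Commute x y
  /-- `τ(a₁ ⋯ aₙ) = 0` for `aᵢ ∈ P sᵢ` with `τ(aᵢ) = 0` and `s₁ ⋯ sₙ` a non-empty reduced word. -/
  independent : ∀ a : List (Σ s, P s), a ≠ [] → cs.IsReduced (a.map Sigma.fst) →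
    (∀ x ∈ a, ⟪Ω, (x.2 : H →L[ℂ] H) Ω⟫_ℂ = 0) →
    ⟪Ω, (a.map fun x => (x.2 : H →L[ℂ] H)).prod Ω⟫_ℂ = 0

/-- `Φ` is the graph product of the state preserving maps `φ s`: for `aᵢ ∈ P sᵢ` with
`τ(aᵢ) = 0` and `s₁ ⋯ sₙ` a reduced word, `Φ(a₁ ⋯ aₙ) = φ_{s₁}(a₁) ⋯ φ_{sₙ}(aₙ)`. -/
structure IsGraphProductMap (N : VonNeumannAlgebra H) (Ω : H) (P : B → VonNeumannAlgebra H)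
    (Φ : N →CP N) (φ : ∀ s, P s →CP P s) : Prop where
  state_preserving : ∀ (s : B) (x : P s),
    ⟪Ω, (φ s x : H →L[ℂ] H) Ω⟫_ℂ = ⟪Ω, (x : H →L[ℂ] H) Ω⟫_ℂ
  map_reduced : ∀ a : List (Σ s, P s), cs.IsReduced (a.map Sigma.fst) →
    (∀ x ∈ a, ⟪Ω, (x.2 : H →L[ℂ] H) Ω⟫_ℂ = 0) →
    ∀ x : N, (x : H →L[ℂ] H) = (a.map fun y => (y.2 : H →L[ℂ] H)).prod →
      (Φ x : H →L[ℂ] H) = (a.map fun y => (φ y.1 y.2 : H →L[ℂ] H)).prod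

end GraphProduct

end CoxeterSystem

end

/-!
The map `Φ_r` is constructed as a compression `x ↦ V* (x ⊗ 1) V` with an isometry `V` from `ℓ²(W)`
to a multiple of `ℓ²(W)`. Such a map is automatically normal, unital and completely positive
(`VonNeumannAlgebra.isNormalMap_of_eq_compression`, `VonNeumannAlgebra.compression`), so the point
is to find `V` for which it preserves `M_q` and maps `T_w` to `r^{|w|} T_w`.

For this, replace every generator `s` by two generators `(s, false)` and `(s, true)` without
relation between them, the commutation relations over `s ≠ t` being those of `s` and `t`. Let `W'`
be the resulting right-angled Coxeter group, and consider on `ℓ²(W')` the Hecke operators `L_a` with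
parameter `p` for the generators `(s, false)` and `0` for the generators `(s, true)`; in other
words, each vertex algebra `M_q(s)` is replaced by its free product with the group algebra of `ℤ/2`.
Since `L_{(s,true)}` is a symmetry, `u_s = c + i d L_{(s,true)}` is unitary if `c² + d² = 1`. The
operators `a_s = u_s L_{(s,false)} u_s*` (`CoxeterSystem.conjOp`) satisfy the Hecke relations and
commute like the `T_s`, so `T_w ↦ a_w = a_{s₁} ⋯ a_{sₙ}` is well defined by Tits' solution of the
word problem (`CoxeterSystem.prod_map_eq_of_isReduced`). The key computation is that the component
of `a_w Ω` in `ℓ²(W) ⊆ ℓ²(W')` is `c^{2|w|} δ_w` (`CoxeterSystem.conjVec_toDouble`). Together with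
the Hecke relations this shows that the vectors `a_w Ω` are orthonormal, so `δ_w ↦ a_w Ω` is an
isometry `U`, and with `c² = r` the compression by `U` of the product of the `L_{(s,false)}` over a
reduced word of `w` maps `Ω` to `r^{|w|} δ_w`. On the other hand, decomposing `W'` into cosets of
`W` shows that `ℓ²(W')` embeds by an isometry `Θ` into a multiple of `ℓ²(W)`, such that
`L_{(s,false)}` becomes `T_s ⊗ 1`
(`CoxeterSystem.exists_isometry_intertwining_leftOp`). Then `V = Θ U`.

That `V* (x ⊗ 1) V` lies in `M_q` is checked on the commutant. The commutation theorem
(`CoxeterSystem.commute_of_commute_rightOp_of_commute_leftOp`) identifies `M_q` with the commutant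
of the right Hecke operators, and `U` intertwines these with right-hand versions of the `a_s`, which
commute with all `L_a`. As `Ω` is separating for `M_q`, the value at `Ω` determines
`Φ_r(T_w) = r^{|w|} T_w`. The same isometry `V` yields the maps `φ_s` on the vertex algebras, which
are spanned by `1` and `T_s`; so elements of trace zero are multiples of `T_s`, and the statements
on graph products reduce to products of the `T_s` over reduced words. Finally, the span of the `T_w`
is dense by the bicommutant theorem, hence a normal map is determined by its values on it
(`VonNeumannAlgebra.IsNormalMap.ext_of_eqOn`).

All right-angled Coxeter combinatorics is derived from the exchange condition
(`CoxeterSystem.exchange`) and the fact that two left descents of an element commute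
(`CoxeterSystem.eq_two_of_isLeftDescent`).
-/

noncomputable section

/-! ### Right-angled Coxeter groups -/

namespace CoxeterMatrix.IsRightAngled

variable {B : Type*} {M : CoxeterMatrix B}

theorem isLiftable (hM : M.IsRightAngled) {G : Type*} [Monoid G] (f : B → G)
    (hsq : ∀ s, f s * f s = 1) (hcomm : ∀ s t, M s t = 2 → f s * f t = f t * f s) :
    M.IsLiftable f := by
  intro s t
  rcases eq_or_ne s t with rfl | hst
  · simp [hsq]
  · rcases hM s t hst with h | h
    · rw [h, pow_two, ← mul_assoc, hcomm s t h, mul_assoc (f t), hsq, mul_one, hsq]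
    · rw [h, pow_zero]

end CoxeterMatrix.IsRightAngled

namespace CoxeterSystem

variable {B W : Type*} [Group W] {M : CoxeterMatrix B} (cs : CoxeterSystem M W)

theorem simple_mul_simple_comm {s t : B} (h : M s t = 2) :
    cs.simple s * cs.simple t = cs.simple t * cs.simple s := by
  have := cs.simple_mul_simple_pow s t
  rw [h, pow_two] at this
  have h2 := eq_inv_of_mul_eq_one_left this
  simpa using h2

open scoped Classical in
/-- Conjugate simple reflections of a right-angled Coxeter group are equal: the parity of the
number of occurrences of a letter is an invariant of the group element. -/
theorem eq_of_simple_mul_eq_mul_simple (hM : M.IsRightAngled) {s t : B} {w : W}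
    (h : cs.simple s * w = w * cs.simple t) : s = t := by
  let f : B → Multiplicative (ZMod 2) := fun a => if a = s then Multiplicative.ofAdd 1 else 1
  have hf : M.IsLiftable f := hM.isLiftable f
    (fun a => by by_cases ha : a = s <;> simp only [f, ha, if_true, if_false] <;> decide)
    (fun _ _ _ => mul_comm _ _)
  have h1 := congrArg (cs.lift ⟨f, hf⟩) h
  rw [map_mul, map_mul, mul_comm, cs.lift_apply_simple hf, cs.lift_apply_simple hf] at h1
  have h2 := mul_left_cancel h1
  by_contra hst
  simp only [f, if_true, if_neg (Ne.symm hst)] at h2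
  exact absurd h2 (by decide)

open scoped Classical in
/-- The action of `W` on `W × ℤ/2` in which `s` conjugates the first entry and records in the
second one whether that entry was `s`. It shows that the parity of the multiplicity of an element
in the inversion sequence of a word depends only on the product of the word. -/
def inversionAction (hM : M.IsRightAngled) : W →* Function.End (W × ZMod 2) :=
  cs.lift ⟨fun s x => (cs.simple s * x.1 * cs.simple s, x.2 + if x.1 = cs.simple s then 1 else 0),
    hM.isLiftable _
      (fun s => by
        funext ⟨x, e⟩
        have h1 : cs.simple s * x * cs.simple s = cs.simple s ↔ x = cs.simple s := by
          constructor
          · intro h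
            have := congrArg (fun y => cs.simple s * y * cs.simple s) h
            simpa [mul_assoc] using this
          · rintro rfl; simp
        refine Prod.ext ?_ ?_
        · show cs.simple s * (cs.simple s * x * cs.simple s) * cs.simple s = x
          simp [mul_assoc]
        · show e + _ + _ = e
          simp only [h1]
          split_ifs
          · rw [add_assoc, show (1 : ZMod 2) + 1 = 0 from rfl, add_zero]
          · simp)
      (fun s t hst => by
        have hc := cs.simple_mul_simple_comm hst
        have key : ∀ (a b : B), cs.simple a * cs.simple b = cs.simple b * cs.simple a →
            ∀ x : W, cs.simple a * x * cs.simple a = cs.simple b ↔ x = cs.simple b := by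
          intro a b hab x
          constructor
          · intro h
            have := congrArg (fun y => cs.simple a * y * cs.simple a) h
            simp only [mul_assoc, cs.simple_mul_simple_self, cs.simple_mul_simple_cancel_left,
              mul_one] at this
            rw [this, ← hab, cs.simple_mul_simple_cancel_left]
          · rintro rfl
            rw [hab, mul_assoc, cs.simple_mul_simple_self, mul_one]
        funext ⟨x, e⟩
        show ((_, _) : W × ZMod 2) = (_, _)
        refine Prod.ext ?_ ?_
        · show cs.simple s * (cs.simple t * x * cs.simple t) * cs.simple s
            = cs.simple t * (cs.simple s * x * cs.simple s) * cs.simple t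
          calc _ = (cs.simple s * cs.simple t) * x * (cs.simple t * cs.simple s) := by group
            _ = _ := by rw [hc]; nth_rewrite 2 [← hc]; group
        · show e + _ + _ = e + _ + _
          simp only [key t s hc.symm, key s t hc]
          ring)⟩

open scoped Classical in
theorem inversionAction_wordProd_inv (hM : M.IsRightAngled) (ω : List B) (t : W) (e : ZMod 2) :
    cs.inversionAction hM (cs.wordProd ω)⁻¹ (t, e)
      = ((cs.wordProd ω)⁻¹ * t * cs.wordProd ω, e + (cs.leftInvSeq ω).count t) := by
  induction ω generalizing t e with
  | nil => simp [Function.End.one_def]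
  | cons s ω ih =>
    have h1 : cs.inversionAction hM (cs.simple s) (t, e)
        = (cs.simple s * t * cs.simple s, e + if t = cs.simple s then 1 else 0) := by
      exact congrFun (cs.lift_apply_simple (G := Function.End (W × ZMod 2)) _ s) (t, e)
    rw [cs.wordProd_cons, mul_inv_rev, map_mul, cs.inv_simple]
    show cs.inversionAction hM (cs.wordProd ω)⁻¹ (cs.inversionAction hM (cs.simple s) (t, e)) = _
    rw [h1, ih]
    refine Prod.ext (by simp [mul_assoc]) ?_
    have h2 : (cs.leftInvSeq (s :: ω)).count t
        = (cs.leftInvSeq ω).count (cs.simple s * t * cs.simple s)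
          + if t = cs.simple s then 1 else 0 := by
      have h3 : t = MulAut.conj (cs.simple s) (cs.simple s * t * cs.simple s) := by
        simp [MulAut.conj_apply, mul_assoc]
      rw [leftInvSeq, List.count_cons]
      congr 1
      · conv_lhs => rw [h3]
        exact List.count_map_of_injective (cs.leftInvSeq ω) _
          (MulAut.conj (cs.simple s)).injective _
      · simp only [beq_iff_eq, @eq_comm _ t]
    show e + _ + _ = e + _
    rw [h2]
    push_cast
    ring

/-- The exchange condition. For a reduced word `ω₁` of `s w`, where `w` is the product of `ω`, the
generator `s` occurs once in the inversion sequence of `s ω₁`; by the invariance of the parity it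
also occurs in that of `ω`. -/
theorem exchange (hM : M.IsRightAngled) {ω : List B} {s : B}
    (h : cs.IsLeftDescent (cs.wordProd ω) s) :
    ∃ j < ω.length, cs.simple s * cs.wordProd ω = cs.wordProd (ω.eraseIdx j) := by
  classical
  obtain ⟨ω₁, hω₁, hw₁⟩ := cs.exists_isReduced (cs.simple s * cs.wordProd ω)
  have hprod : cs.wordProd (s :: ω₁) = cs.wordProd ω := by
    rw [cs.wordProd_cons, ← hw₁, cs.simple_mul_simple_cancel_left]
  have hnot : cs.simple s ∉ cs.leftInvSeq ω₁ := by
    intro hmem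
    have := (cs.isLeftInversion_of_mem_leftInvSeq hω₁ hmem).2
    rw [← hw₁, cs.simple_mul_simple_cancel_left] at this
    exact absurd h (not_lt.2 this.le)
  have hcount : (cs.leftInvSeq (s :: ω₁)).count (cs.simple s) = 1 := by
    rw [leftInvSeq, List.count_cons]
    have h4 :
        (List.map (MulAut.conj (cs.simple s)) (cs.leftInvSeq ω₁)).count (cs.simple s) = 0 := by
      rw [List.count_eq_zero]
      intro hmem
      obtain ⟨t, ht, hts⟩ := List.mem_map.1 hmem
      have : t = cs.simple s := by
        rw [MulAut.conj_apply, mul_inv_eq_iff_eq_mul] at hts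
        exact mul_left_cancel hts
      exact hnot (this ▸ ht)
    rw [h4]
    simp
  have h1 := cs.inversionAction_wordProd_inv hM (s :: ω₁) (cs.simple s) 0
  have h2 := cs.inversionAction_wordProd_inv hM ω (cs.simple s) 0
  rw [hprod, h2, hcount] at h1
  have h3 := congrArg Prod.snd h1
  simp only [zero_add] at h3
  have hmem : cs.simple s ∈ cs.leftInvSeq ω := by
    by_contra hn
    rw [List.count_eq_zero.2 hn] at h3
    exact absurd h3 (by decide)
  obtain ⟨j, hj, hjs⟩ := List.mem_iff_getElem.1 hmem
  have hj' : j < ω.length := by simpa using hj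
  refine ⟨j, hj', ?_⟩
  have := cs.getD_leftInvSeq_mul_wordProd ω j
  rwa [List.getD_eq_getElem _ _ hj, hjs] at this

/-- Adding a letter on the right creates a new left descent only if it amounts to multiplying by
that descent on the left. -/
theorem simple_mul_eq_mul_simple_of_isLeftDescent (hM : M.IsRightAngled) {s t : B} {w : W}
    (hs : ¬ cs.IsLeftDescent w s) (h : cs.IsLeftDescent (w * cs.simple t) s) :
    cs.simple s * w = w * cs.simple t := by
  obtain ⟨ω, hω, rfl⟩ := cs.exists_isReduced w
  have hcat : cs.wordProd (ω ++ [t]) = cs.wordProd ω * cs.simple t := by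
    rw [cs.wordProd_append, cs.wordProd_singleton]
  rw [← hcat] at h
  obtain ⟨j, hj, hje⟩ := cs.exchange hM h
  rw [hcat] at hje
  rcases lt_or_ge j ω.length with hlt | hge
  · rw [List.eraseIdx_append_of_lt_length hlt, cs.wordProd_append, cs.wordProd_singleton,
      ← mul_assoc] at hje
    have h1 := mul_right_cancel hje
    have h2 := cs.length_wordProd_le (ω.eraseIdx j)
    rw [← h1] at h2
    rw [cs.not_isLeftDescent_iff, hω.eq] at hs
    have h3 := List.length_eraseIdx_of_lt hlt
    omega
  · have hj' : j = ω.length := by simp at hj; omega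
    subst hj'
    rw [List.eraseIdx_append_of_length_le le_rfl] at hje
    simp only [Nat.sub_self, List.eraseIdx_zero, List.tail_cons, List.append_nil] at hje
    have := congrArg (fun y => cs.simple s * y) hje
    simp only [cs.simple_mul_simple_cancel_left] at this
    exact this.symm

theorem isLeftDescent_mul_simple_iff (hM : M.IsRightAngled) {s t : B} {w : W}
    (h : cs.simple s * w ≠ w * cs.simple t) :
    cs.IsLeftDescent (w * cs.simple t) s ↔ cs.IsLeftDescent w s := by
  constructor
  · intro h1
    by_contra h2
    exact h (cs.simple_mul_eq_mul_simple_of_isLeftDescent hM h2 h1)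
  · intro h1
    by_contra h2
    have h3 : cs.IsLeftDescent (w * cs.simple t * cs.simple t) s := by simpa using h1
    have h4 := cs.simple_mul_eq_mul_simple_of_isLeftDescent hM h2 h3
    refine h ?_
    rw [← mul_assoc] at h4
    have := congrArg (· * cs.simple t) h4
    simpa using this

theorem isRightDescent_simple_mul_iff (hM : M.IsRightAngled) {s t : B} {w : W}
    (h : cs.simple s * w ≠ w * cs.simple t) :
    cs.IsRightDescent (cs.simple s * w) t ↔ cs.IsRightDescent w t := by
  have h' : cs.simple t * w⁻¹ ≠ w⁻¹ * cs.simple s := by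
    intro h1
    apply h
    have := congrArg (·⁻¹) h1
    simpa using this.symm
  have := cs.isLeftDescent_mul_simple_iff hM h'
  rw [← cs.isRightDescent_inv_iff, ← cs.isRightDescent_inv_iff] at this
  simpa using this

/-! ### Descents and the word problem -/

/-- The alternating word `s t s ⋯` of length `k` starting with `s`. -/
def alternating (s t : B) : ℕ → List B
  | 0 => []
  | k + 1 => s :: (alternating t s k)

theorem length_alternating (s t : B) (k : ℕ) : (alternating s t k).length = k := by
  induction k generalizing s t with
  | zero => rfl
  | succ k ih => simp [alternating, ih]

open scoped Classical in
/-- The action on `ℤ` of the generators of a right-angled Coxeter group: `s` and `t` act as the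
reflections in `1/2` and `-1/2`, and the other generators trivially. -/
def lineReflection (s t a : B) : Function.End ℤ :=
  fun n => if a = s then 1 - n else if a = t then -1 - n else n

theorem lineReflection_left (s t : B) (n : ℤ) : lineReflection s t s n = 1 - n := if_pos rfl

theorem lineReflection_right {s t : B} (h : s ≠ t) (n : ℤ) :
    lineReflection s t t n = -1 - n := by
  rw [lineReflection, if_neg h.symm, if_pos rfl]

theorem lineReflection_of_ne {s t a : B} (hs : a ≠ s) (ht : a ≠ t) (n : ℤ) :
    lineReflection s t a n = n := by
  rw [lineReflection, if_neg hs, if_neg ht]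

theorem isLiftable_lineReflection (hM : M.IsRightAngled) {s t : B} (hst : M s t = 0) :
    M.IsLiftable (lineReflection s t) := by
  have hne : s ≠ t := by rintro rfl; simp at hst
  refine hM.isLiftable _ (fun a => ?_) (fun a b hab => ?_)
  · funext n
    show lineReflection s t a (lineReflection s t a n) = n
    rcases eq_or_ne a s with rfl | h1
    · simp only [lineReflection_left]; ring
    · rcases eq_or_ne a t with rfl | h2
      · simp only [lineReflection_right hne]; ring
      · simp only [lineReflection_of_ne h1 h2]
  · funext n
    show lineReflection s t a (lineReflection s t b n)
      = lineReflection s t b (lineReflection s t a n)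
    by_cases ha : a ≠ s ∧ a ≠ t
    · simp only [lineReflection_of_ne ha.1 ha.2]
    by_cases hb : b ≠ s ∧ b ≠ t
    · simp only [lineReflection_of_ne hb.1 hb.2]
    have hts : M t s = 0 := by rw [M.symmetric]; exact hst
    have ha' : a = s ∨ a = t := by tauto
    have hb' : b = s ∨ b = t := by tauto
    rcases ha' with rfl | rfl <;> rcases hb' with rfl | rfl <;> simp_all

/-- If `m(s,t) = ∞`, the alternating word `s t s ⋯` is reduced: on `ℤ`, a word of length `k` of
the line reflections moves `0` by at most `k`, and the alternating one by exactly `k`. -/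
theorem simple_mul_wordProd_alternating_ne (hM : M.IsRightAngled) {s t : B} (hst : M s t = 0)
    (k : ℕ) (ω : List B) (hlen : ω.length < k) :
    cs.wordProd (alternating s t k) ≠ cs.wordProd ω := by
  have hne : s ≠ t := by rintro rfl; simp at hst
  have hf := isLiftable_lineReflection hM hst
  let φ : W →* Function.End ℤ := cs.lift ⟨lineReflection s t, hf⟩
  have hφ : ∀ a (w : W) (n : ℤ), φ (cs.simple a * w) n = lineReflection s t a (φ w n) := by
    intro a w n
    rw [map_mul]
    exact congrFun (cs.lift_apply_simple hf a) (φ w n)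
  have h1 : ∀ k : ℕ, φ (cs.wordProd (alternating s t k)) 0 = k ∧
      φ (cs.wordProd (alternating t s k)) 0 = -k := by
    intro k
    induction k with
    | zero => simp [alternating, Function.End.one_def]
    | succ k ih =>
      simp only [alternating, cs.wordProd_cons, hφ, ih, lineReflection_left,
        lineReflection_right hne]
      push_cast
      constructor <;> ring
  have h2 : ∀ ω : List B, |φ (cs.wordProd ω) 0| ≤ ω.length := by
    intro ω
    induction ω with
    | nil => simp [Function.End.one_def]
    | cons a ω ih =>
      rw [cs.wordProd_cons, hφ, List.length_cons]
      rw [abs_le] at ih ⊢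
      unfold lineReflection
      split_ifs <;> push_cast <;> constructor <;> omega
  intro h
  have h3 := h2 ω
  rw [← h, (h1 k).1, abs_of_nonneg (by positivity)] at h3
  omega

/-- Two left descents of an element commute. -/
theorem eq_two_of_isLeftDescent (hM : M.IsRightAngled) {s t : B} (hne : s ≠ t) {w : W}
    (hs : cs.IsLeftDescent w s) (ht : cs.IsLeftDescent w t) : M s t = 2 := by
  refine (hM s t hne).resolve_right fun hst => ?_
  -- If `m(s,t) = ∞`, then `w` starts with arbitrarily long alternating words.
  have key : ∀ k : ℕ, ∀ s t : B, M s t = 0 → cs.IsLeftDescent w s → cs.IsLeftDescent w t →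
      ∃ u : W, w = cs.wordProd (alternating s t k) * u ∧ cs.length w = k + cs.length u := by
    intro k
    induction k with
    | zero => intro s t _ _ _; exact ⟨w, by simp [alternating], by simp⟩
    | succ k ih =>
      intro s t hst hs ht
      have hts : M t s = 0 := by rw [M.symmetric]; exact hst
      obtain ⟨u, hu, hlen⟩ := ih t s hts ht hs
      obtain ⟨ω, hω, rfl⟩ := cs.exists_isReduced u
      rw [← cs.wordProd_append] at hu
      rw [hu] at hs
      obtain ⟨j, hj, hje⟩ := cs.exchange hM hs
      rw [← hu] at hje hs
      rcases lt_or_ge j k with hjk | hjk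
      · rw [List.eraseIdx_append_of_lt_length (by rwa [length_alternating]), cs.wordProd_append,
          hu, cs.wordProd_append, ← mul_assoc, mul_left_inj, ← cs.wordProd_cons] at hje
        exact absurd hje (cs.simple_mul_wordProd_alternating_ne hM hst (k + 1) _
          (by rw [List.length_eraseIdx_of_lt (by rwa [length_alternating]), length_alternating]
              omega))
      · rw [List.eraseIdx_append_of_length_le (by rwa [length_alternating]),
          cs.wordProd_append] at hje
        have hw : w = cs.wordProd (alternating s t (k + 1)) *
            cs.wordProd (ω.eraseIdx (j - (alternating t s k).length)) := by
          rw [alternating, cs.wordProd_cons, mul_assoc, ← hje, cs.simple_mul_simple_cancel_left]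
        refine ⟨_, hw, ?_⟩
        have h1 := cs.length_wordProd_le (ω.eraseIdx (j - (alternating t s k).length))
        rw [List.length_eraseIdx_of_lt (by
          rw [length_alternating]; rw [List.length_append, length_alternating] at hj; omega)] at h1
        have h2 := cs.length_mul_le (cs.wordProd (alternating s t (k + 1)))
          (cs.wordProd (ω.eraseIdx (j - (alternating t s k).length)))
        have h3 := cs.length_wordProd_le (alternating s t (k + 1))
        rw [← hw] at h2
        rw [length_alternating] at h3
        rw [hω.eq] at hlen
        rw [List.length_append, length_alternating] at hj
        omega
  obtain ⟨u, -, hu⟩ := key (cs.length w + 1) s t hst hs ht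
  omega

/-- Multiplying by a commuting generator does not affect a descent. -/
theorem isLeftDescent_simple_mul_iff (hM : M.IsRightAngled) {s t : B} (h : M s t = 2) {w : W} :
    cs.IsLeftDescent (cs.simple s * w) t ↔ cs.IsLeftDescent w t := by
  have hne : s ≠ t := by rintro rfl; simp at h
  have hc := cs.simple_mul_simple_comm h
  have key : ∀ w : W, cs.IsLeftDescent w t → cs.IsLeftDescent (cs.simple s * w) t := by
    intro w hw
    by_cases hs : cs.IsLeftDescent w s
    · obtain ⟨ω, hω, hωw⟩ := cs.exists_isReduced (cs.simple s * w)
      have hw' : w = cs.wordProd (s :: ω) := by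
        rw [cs.wordProd_cons, ← hωw, cs.simple_mul_simple_cancel_left]
      obtain ⟨j, hj, hje⟩ := cs.exchange hM (hw' ▸ hw)
      rcases j with _ | j
      · exfalso
        rw [List.eraseIdx_zero, List.tail_cons, ← hw', ← hωw] at hje
        have h1 : cs.simple t * 1 = 1 * cs.simple s := by simpa using mul_right_cancel hje
        exact hne (cs.eq_of_simple_mul_eq_mul_simple hM h1).symm
      · rw [List.eraseIdx_cons_succ, ← hw', cs.wordProd_cons] at hje
        have h1 : cs.simple t * (cs.simple s * w) = cs.wordProd (ω.eraseIdx j) := by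
          rw [← mul_assoc, ← hc, mul_assoc, hje, cs.simple_mul_simple_cancel_left]
        unfold IsLeftDescent
        rw [h1]
        have h2 := cs.length_wordProd_le (ω.eraseIdx j)
        have hj' : j < ω.length := by simpa using hj
        rw [List.length_eraseIdx_of_lt hj'] at h2
        rw [hωw, hω.eq]
        omega
    · rw [cs.not_isLeftDescent_iff] at hs
      unfold IsLeftDescent at hw ⊢
      rw [← mul_assoc, ← hc, mul_assoc, hs]
      rcases cs.length_simple_mul (cs.simple t * w) s with h1 | h1 <;> omega
  refine ⟨fun h1 => ?_, key w⟩
  have := key _ h1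
  rwa [cs.simple_mul_simple_cancel_left] at this

/-- Tits' solution of the word problem: a family of elements of a monoid which commute whenever
the corresponding generators do takes the same value on all reduced words of an element. -/
theorem prod_map_eq_of_isReduced (hM : M.IsRightAngled) {G : Type*} [Monoid G] (a : B → G)
    (ha : ∀ s t, M s t = 2 → a s * a t = a t * a s) {ω₁ ω₂ : List B} (h₁ : cs.IsReduced ω₁)
    (h₂ : cs.IsReduced ω₂) (h : cs.wordProd ω₁ = cs.wordProd ω₂) :
    (ω₁.map a).prod = (ω₂.map a).prod := by
  have hlen : ω₁.length = ω₂.length := by rw [← h₁.eq, ← h₂.eq, h]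
  induction hn : ω₁.length using Nat.strong_induction_on generalizing ω₁ ω₂ with
  | _ n ih =>
  rcases ω₁ with _ | ⟨s, α⟩
  · rw [List.eq_nil_of_length_eq_zero (l := ω₂) (by simpa using hlen.symm)]
  rcases ω₂ with _ | ⟨t, β⟩
  · simp at hlen
  have hα : cs.IsReduced α := by simpa using h₁.drop 1
  have hβ : cs.IsReduced β := by simpa using h₂.drop 1
  have hlen' : α.length = β.length := by simpa using hlen
  have hn' : α.length + 1 = n := by simpa using hn
  rcases eq_or_ne s t with rfl | hne
  · rw [List.map_cons, List.map_cons, List.prod_cons, List.prod_cons,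
      ih α.length (by omega) hα hβ (by simpa [cs.wordProd_cons] using h) hlen' rfl]
  have hdesc : ∀ {s : B} {α : List B}, cs.IsReduced (s :: α) → cs.IsReduced α →
      cs.IsLeftDescent (cs.wordProd (s :: α)) s := by
    intro s α h1 h2
    unfold IsLeftDescent
    rw [h1.eq, cs.wordProd_cons, cs.simple_mul_simple_cancel_left, h2.eq]
    simp
  have hs := hdesc h₁ hα
  have ht := hdesc h₂ hβ
  rw [← h] at ht
  have hst := cs.eq_two_of_isLeftDescent hM hne hs ht
  have ht' := (cs.isLeftDescent_simple_mul_iff hM hst).2 ht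
  rw [cs.wordProd_cons, cs.simple_mul_simple_cancel_left] at ht'
  obtain ⟨γ, hγ, hγw⟩ := cs.exists_isReduced (cs.simple t * cs.wordProd α)
  have hγlen : γ.length + 1 = α.length := by
    rw [← hγ.eq, ← hγw, ← hα.eq]
    exact (cs.isLeftDescent_iff).1 ht'
  have e1 : cs.wordProd α = cs.wordProd (t :: γ) := by
    rw [cs.wordProd_cons, ← hγw, cs.simple_mul_simple_cancel_left]
  have e2 : cs.wordProd (s :: γ) = cs.wordProd β := by
    rw [cs.wordProd_cons, ← hγw, ← mul_assoc, cs.simple_mul_simple_comm hst, mul_assoc,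
      ← cs.wordProd_cons, h, cs.wordProd_cons, cs.simple_mul_simple_cancel_left]
  have r1 : cs.IsReduced (t :: γ) := by
    unfold IsReduced; rw [← e1, hα.eq, List.length_cons, hγlen]
  have r2 : cs.IsReduced (s :: γ) := by
    unfold IsReduced; rw [e2, hβ.eq, List.length_cons, hγlen, hlen']
  rw [List.map_cons, List.prod_cons, ih α.length (by omega) hα r1 e1 (by simp [hγlen]) rfl,
    List.map_cons, List.prod_cons, ← mul_assoc, ha s t hst, mul_assoc]
  have := ih (s :: γ).length (by simp; omega) r2 hβ e2 (by simp; omega) rfl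
  rw [List.map_cons, List.prod_cons] at this
  rw [this, List.map_cons, List.prod_cons]

end CoxeterSystem

/-! ### Operators on `ℓ²(W)` -/

namespace EllTwo

variable {W : Type*}

open scoped Classical in
theorem delta_apply (w v : W) : (delta w : EllTwo W) v = if v = w then 1 else 0 := by
  simp [delta, lp.single_apply, Pi.single_apply]

@[simp]
theorem delta_self (w : W) : (delta w : EllTwo W) w = 1 := by simp [delta_apply]

theorem delta_of_ne {w v : W} (h : v ≠ w) : (delta w : EllTwo W) v = 0 := by
  simp [delta_apply, h]

theorem inner_delta_left (w : W) (f : EllTwo W) : ⟪(delta w : EllTwo W), f⟫_ℂ = f w := by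
  classical
  have := lp.inner_single_left (𝕜 := ℂ) w (1 : ℂ) f
  simp only [RCLike.inner_apply, map_one, mul_one] at this
  rw [← this]
  congr!

theorem inner_delta_right (w : W) (f : EllTwo W) :
    ⟪f, (delta w : EllTwo W)⟫_ℂ = (starRingEnd ℂ) (f w) := by
  rw [← inner_conj_symm, inner_delta_left]

open scoped Classical in
theorem orthonormal_delta : Orthonormal ℂ (delta : W → EllTwo W) := by
  rw [orthonormal_iff_ite]
  intro i j
  rw [inner_delta_left, delta_apply]

theorem norm_delta (w : W) : ‖(delta w : EllTwo W)‖ = 1 := orthonormal_delta.norm_eq_one w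

theorem topologicalClosure_span_delta :
    (Submodule.span ℂ (Set.range (delta : W → EllTwo W))).topologicalClosure = ⊤ := by
  rw [Submodule.topologicalClosure_eq_top_iff, Submodule.eq_bot_iff]
  intro f hf
  ext w
  have := (Submodule.mem_orthogonal _ _).1 hf (delta w) (Submodule.subset_span ⟨w, rfl⟩)
  rwa [inner_delta_left] at this

theorem continuousLinearMap_ext {E : Type*} [NormedAddCommGroup E] [NormedSpace ℂ E]
    {x y : EllTwo W →L[ℂ] E} (h : ∀ w, x (delta w) = y (delta w)) : x = y := by
  refine ContinuousLinearMap.ext_on (s := Set.range delta) ?_ ?_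
  · exact Submodule.dense_iff_topologicalClosure_eq_top.2 topologicalClosure_span_delta
  · rintro _ ⟨w, rfl⟩
    exact h w

theorem restrict_apply (A : Set W) (f : EllTwo W) (w : W) :
    restrict A f w = A.indicator f w := rfl

theorem isSelfAdjoint_restrict (A : Set W) : IsSelfAdjoint (restrict A) := by
  rw [ContinuousLinearMap.isSelfAdjoint_iff_isSymmetric]
  intro f g
  show ⟪restrict A f, g⟫_ℂ = ⟪f, restrict A g⟫_ℂ
  rw [lp.inner_eq_tsum, lp.inner_eq_tsum]
  refine tsum_congr fun w => ?_
  rw [restrict_apply, restrict_apply]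
  by_cases hw : w ∈ A <;> simp [hw]

section Group

variable [Group W]

theorem _root_.LinearIsometry.isSelfAdjoint_of_involutive {H : Type*} [NormedAddCommGroup H]
    [InnerProductSpace ℂ H] [CompleteSpace H] (J : H →ₗᵢ[ℂ] H) (hJ : ∀ f, J (J f) = f) :
    IsSelfAdjoint J.toContinuousLinearMap := by
  rw [ContinuousLinearMap.isSelfAdjoint_iff_isSymmetric]
  intro f g
  show ⟪J f, g⟫_ℂ = ⟪f, J g⟫_ℂ
  rw [← J.inner_map_map, hJ]

/-- The unitary `δ_w ↦ δ_{w⁻¹}`. -/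
def inversion : EllTwo W →ₗᵢ[ℂ] EllTwo W where
  toFun f := ⟨fun w => f w⁻¹, by
    have hf := (memℓp_gen_iff (by norm_num : 0 < (2 : ℝ≥0∞).toReal)).1 (lp.memℓp f)
    exact (memℓp_gen_iff (by norm_num : 0 < (2 : ℝ≥0∞).toReal)).2
      ((Equiv.inv W).summable_iff.2 hf)⟩
  map_add' _ _ := rfl
  map_smul' _ _ := rfl
  norm_map' f := by
    have h2 : 0 < (2 : ℝ≥0∞).toReal := by norm_num
    rw [lp.norm_eq_tsum_rpow h2, lp.norm_eq_tsum_rpow h2]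
    congr 1
    exact (Equiv.inv W).tsum_eq fun w => ‖f w‖ ^ (2 : ℝ≥0∞).toReal

/-- `EllTwo.inversion` as an element of the algebra of bounded operators. -/
def inversionOp : EllTwo W →L[ℂ] EllTwo W := (inversion : EllTwo W →ₗᵢ[ℂ] _).toContinuousLinearMap

theorem inversionOp_apply (f : EllTwo W) (w : W) : inversionOp f w = f w⁻¹ := rfl

theorem inversionOp_delta (w : W) :
    inversionOp (delta w : EllTwo W) = delta w⁻¹ := by
  ext v
  rw [inversionOp_apply, delta_apply, delta_apply]
  by_cases h : v⁻¹ = w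
  · rw [if_pos h, if_pos (inv_eq_iff_eq_inv.1 h)]
  · rw [if_neg h, if_neg fun h' => h (inv_eq_iff_eq_inv.2 h')]

theorem inversionOp_mul_self : (inversionOp : EllTwo W →L[ℂ] _) * inversionOp = 1 := by
  ext f w
  show f w⁻¹⁻¹ = f w
  rw [inv_inv]

theorem isSelfAdjoint_inversionOp : IsSelfAdjoint (inversionOp : EllTwo W →L[ℂ] _) :=
  LinearIsometry.isSelfAdjoint_of_involutive _ fun f =>
    congrFun (congrArg DFunLike.coe inversionOp_mul_self) f

theorem inversionOp_conj_mul (x y : EllTwo W →L[ℂ] EllTwo W) :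
    inversionOp * (x * y) * inversionOp
      = (inversionOp * x * inversionOp) * (inversionOp * y * inversionOp) := by
  simp only [mul_assoc]
  rw [← mul_assoc inversionOp inversionOp, inversionOp_mul_self, one_mul]

end Group

end EllTwo

theorem Commute.prod_map_right {ι R : Type*} [Monoid R] {x : R} {a : ι → R}
    (h : ∀ i, Commute x (a i)) (l : List ι) : Commute x (l.map a).prod := by
  refine Commute.list_prod_right _ _ fun y hy => ?_
  obtain ⟨i, -, rfl⟩ := List.mem_map.1 hy
  exact h i

namespace CoxeterSystem

open EllTwo

variable {B W : Type*} [Group W] {M : CoxeterMatrix B} (cs : CoxeterSystem M W) (p : B → ℝ)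

/-- The Hecke operator of `s` with parameter `p s`, acting on the left: `δ_w ↦ δ_{sw}` if
`|sw| > |w|`, and `δ_w ↦ δ_{sw} + p_s δ_w` otherwise. With the constant parameter
`(q - 1) / √q` it is `heckeOp`. -/
def leftOp (s : B) : EllTwo W →L[ℂ] EllTwo W :=
  (translate (cs.simple s)).toContinuousLinearMap
    + ((p s : ℝ) : ℂ) • restrict {w | cs.IsLeftDescent w s}

/-- The Hecke operator of `s` with parameter `p s`, acting on the right. -/
def rightOp (s : B) : EllTwo W →L[ℂ] EllTwo W := inversionOp * cs.leftOp p s * inversionOp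

open scoped Classical in
theorem leftOp_apply (s : B) (f : EllTwo W) (w : W) :
    cs.leftOp p s f w
      = f (cs.simple s * w) + if cs.IsLeftDescent w s then (p s : ℂ) * f w else 0 := by
  have : cs.leftOp p s f w = f ((cs.simple s)⁻¹ * w)
    + (p s : ℂ) * Set.indicator {w | cs.IsLeftDescent w s} f w := rfl
  rw [this, cs.inv_simple, Set.indicator_apply]
  simp only [Set.mem_ofPred_eq, mul_ite, mul_zero]

open scoped Classical in
theorem rightOp_apply (s : B) (f : EllTwo W) (w : W) :
    cs.rightOp p s f w
      = f (w * cs.simple s) + if cs.IsRightDescent w s then (p s : ℂ) * f w else 0 := by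
  show cs.leftOp p s (inversionOp f) w⁻¹ = _
  rw [leftOp_apply, inversionOp_apply, inversionOp_apply, cs.isLeftDescent_inv_iff]
  simp

theorem leftOp_delta_of_not_isLeftDescent {s : B} {w : W} (h : ¬ cs.IsLeftDescent w s) :
    cs.leftOp p s (delta w) = delta (cs.simple s * w) := by
  classical
  ext v
  rw [leftOp_apply, delta_apply, delta_apply, delta_apply]
  have h1 : cs.simple s * v = w ↔ v = cs.simple s * w := by
    constructor <;> rintro rfl <;> simp
  simp only [h1]
  by_cases hv : v = w
  · subst hv; simp [h]
  · simp [hv]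

theorem isSelfAdjoint_leftOp (s : B) : IsSelfAdjoint (cs.leftOp p s) := by
  refine IsSelfAdjoint.add ?_ ?_
  · refine LinearIsometry.isSelfAdjoint_of_involutive _ fun f => ?_
    ext w
    show f ((cs.simple s)⁻¹ * ((cs.simple s)⁻¹ * w)) = f w
    simp
  · exact IsSelfAdjoint.smul (Complex.conj_ofReal _) (isSelfAdjoint_restrict _)

theorem leftOp_mul_self (s : B) :
    cs.leftOp p s * cs.leftOp p s = 1 + (p s : ℂ) • cs.leftOp p s := by
  classical
  ext f w
  show cs.leftOp p s (cs.leftOp p s f) w = f w + (p s : ℂ) * cs.leftOp p s f w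
  have h := cs.isLeftDescent_iff_not_isLeftDescent_mul (w := w) (i := s)
  simp only [leftOp_apply, cs.simple_mul_simple_cancel_left]
  by_cases hw : cs.IsLeftDescent w s
  · rw [if_pos hw, if_neg (h.1 hw), if_pos hw]
    ring
  · have h1 : cs.IsLeftDescent (cs.simple s * w) s := by
      by_contra h2; exact hw (h.2 h2)
    rw [if_neg hw, if_pos h1, if_neg hw]
    ring

theorem commute_leftOp (hM : M.IsRightAngled) {s t : B} (hst : M s t = 2) :
    cs.leftOp p s * cs.leftOp p t = cs.leftOp p t * cs.leftOp p s := by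
  classical
  have hts : M t s = 2 := by rw [M.symmetric]; exact hst
  ext f w
  show cs.leftOp p s (cs.leftOp p t f) w = cs.leftOp p t (cs.leftOp p s f) w
  simp only [leftOp_apply, cs.isLeftDescent_simple_mul_iff hM hst,
    cs.isLeftDescent_simple_mul_iff hM hts]
  rw [← mul_assoc, ← mul_assoc, cs.simple_mul_simple_comm hst]
  split_ifs <;> ring

/-- The left and right Hecke operators commute. Their descent conditions are independent at `w`
unless `s w = w t`, and then `s = t`. -/
theorem commute_leftOp_rightOp (hM : M.IsRightAngled) (s t : B) :
    cs.leftOp p s * cs.rightOp p t = cs.rightOp p t * cs.leftOp p s := by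
  classical
  ext f w
  show cs.leftOp p s (cs.rightOp p t f) w = cs.rightOp p t (cs.leftOp p s f) w
  simp only [leftOp_apply, rightOp_apply, mul_assoc]
  by_cases h : cs.simple s * w = w * cs.simple t
  · obtain rfl := cs.eq_of_simple_mul_eq_mul_simple hM h
    have h1 : cs.IsRightDescent w s ↔ cs.IsLeftDescent w s := by
      unfold IsRightDescent IsLeftDescent; rw [h]
    have h2 : cs.IsRightDescent (w * cs.simple s) s ↔ ¬ cs.IsRightDescent w s := by
      rw [cs.isRightDescent_iff_not_isRightDescent_mul (w := w), not_not]
    have h3 : cs.IsLeftDescent (w * cs.simple s) s ↔ ¬ cs.IsLeftDescent w s := by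
      rw [← h, cs.isLeftDescent_iff_not_isLeftDescent_mul (w := w), not_not]
    simp only [h, h2, h3, h1]
  · simp only [cs.isLeftDescent_mul_simple_iff hM h, cs.isRightDescent_simple_mul_iff hM h]
    split_ifs <;> ring

theorem isSelfAdjoint_rightOp (s : B) : IsSelfAdjoint (cs.rightOp p s) := by
  have h : star (inversionOp : EllTwo W →L[ℂ] _) = inversionOp := isSelfAdjoint_inversionOp
  rw [IsSelfAdjoint, rightOp, star_mul, star_mul, h, (cs.isSelfAdjoint_leftOp p s).star_eq,
    mul_assoc]

/-! ### The Hecke algebra and its commutant -/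

theorem prod_leftOp_delta_one {ω : List B} (hω : cs.IsReduced ω) :
    (ω.map (cs.leftOp p)).prod (delta 1) = delta (cs.wordProd ω) := by
  induction ω with
  | nil => simp
  | cons s ω ih =>
    have hω' : cs.IsReduced ω := by simpa using hω.drop 1
    have hlt : ¬ cs.IsLeftDescent (cs.wordProd ω) s := by
      rw [cs.not_isLeftDescent_iff, ← cs.wordProd_cons, hω.eq, hω'.eq, List.length_cons]
    rw [List.map_cons, List.prod_cons, cs.wordProd_cons,
      ← cs.leftOp_delta_of_not_isLeftDescent p hlt, ← ih hω']
    rfl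

theorem star_prod_leftOp (ω : List B) :
    star (ω.map (cs.leftOp p)).prod = (ω.reverse.map (cs.leftOp p)).prod := by
  induction ω with
  | nil => simp
  | cons s ω ih =>
    simp [star_mul, ih, (cs.isSelfAdjoint_leftOp p s).star_eq]

theorem inversionOp_prod_leftOp (ω : List B) :
    inversionOp * (ω.map (cs.leftOp p)).prod * inversionOp = (ω.map (cs.rightOp p)).prod := by
  induction ω with
  | nil => simp [inversionOp_mul_self]
  | cons s ω ih =>
    rw [List.map_cons, List.prod_cons, inversionOp_conj_mul, ih, List.map_cons, List.prod_cons]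
    rfl

theorem prod_rightOp_delta_one {ω : List B} (hω : cs.IsReduced ω) :
    (ω.map (cs.rightOp p)).prod (delta 1) = delta (cs.wordProd ω)⁻¹ := by
  rw [← inversionOp_prod_leftOp]
  show inversionOp ((ω.map (cs.leftOp p)).prod (inversionOp (delta 1))) = _
  rw [inversionOp_delta, inv_one, cs.prod_leftOp_delta_one p hω, inversionOp_delta]

theorem star_prod_rightOp (ω : List B) :
    star (ω.map (cs.rightOp p)).prod = (ω.reverse.map (cs.rightOp p)).prod := by
  induction ω with
  | nil => simp
  | cons s ω ih =>
    simp [star_mul, ih, (cs.isSelfAdjoint_rightOp p s).star_eq]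

theorem _root_.ContinuousLinearMap.apply_apply_of_commute {H : Type*} [NormedAddCommGroup H]
    [NormedSpace ℂ H] {x y : H →L[ℂ] H} (h : Commute x y) (f : H) : x (y f) = y (x f) :=
  congrFun (congrArg DFunLike.coe h.eq) f

/-- `Ω = δ_e` is separating for the commutant of the right Hecke operators. -/
theorem eq_of_apply_delta_one {x y : EllTwo W →L[ℂ] EllTwo W}
    (hx : ∀ s, Commute x (cs.rightOp p s)) (hy : ∀ s, Commute y (cs.rightOp p s))
    (h : x (delta 1) = y (delta 1)) : x = y := by
  refine continuousLinearMap_ext fun w => ?_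
  obtain ⟨ω, hω, hw⟩ := cs.exists_isReduced w⁻¹
  have h1 : delta w = (ω.map (cs.rightOp p)).prod (delta 1) := by
    rw [cs.prod_rightOp_delta_one p hω, ← hw, inv_inv]
  have hc : ∀ x : EllTwo W →L[ℂ] EllTwo W, (∀ s, Commute x (cs.rightOp p s)) →
      x (delta w) = (ω.map (cs.rightOp p)).prod (x (delta 1)) := by
    intro x hx
    rw [h1, ContinuousLinearMap.apply_apply_of_commute (Commute.prod_map_right hx ω)]
  rw [hc x hx, hc y hy, h]

theorem star_apply_delta_one_of_commute {x z : EllTwo W →L[ℂ] EllTwo W} (hc : Commute x z) {g : W}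
    (h1 : z (delta 1) = delta g) (h2 : star z (delta 1) = delta g⁻¹) :
    (star x) (delta 1) g = (starRingEnd ℂ) (x (delta 1) g⁻¹) := by
  rw [← inner_delta_left, ← inner_delta_right, ContinuousLinearMap.star_eq_adjoint,
    ContinuousLinearMap.adjoint_inner_right, ← h1, ContinuousLinearMap.apply_apply_of_commute hc,
    ← h2, ContinuousLinearMap.star_eq_adjoint, ContinuousLinearMap.adjoint_inner_right]

theorem star_apply_delta_one_of_commute_rightOp {x : EllTwo W →L[ℂ] EllTwo W}
    (hx : ∀ s, Commute x (cs.rightOp p s)) (g : W) :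
    (star x) (delta 1) g = (starRingEnd ℂ) (x (delta 1) g⁻¹) := by
  obtain ⟨ω, hω, hw⟩ := cs.exists_isReduced g⁻¹
  refine star_apply_delta_one_of_commute (Commute.prod_map_right hx ω) ?_ ?_
  · rw [cs.prod_rightOp_delta_one p hω, ← hw, inv_inv]
  · rw [star_prod_rightOp, cs.prod_rightOp_delta_one p hω.reverse, cs.wordProd_reverse, inv_inv, hw]

theorem star_apply_delta_one_of_commute_leftOp {x : EllTwo W →L[ℂ] EllTwo W}
    (hx : ∀ s, Commute x (cs.leftOp p s)) (g : W) :
    (star x) (delta 1) g = (starRingEnd ℂ) (x (delta 1) g⁻¹) := by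
  obtain ⟨ω, hω, hw⟩ := cs.exists_isReduced g
  refine star_apply_delta_one_of_commute (Commute.prod_map_right hx ω) ?_ ?_
  · rw [cs.prod_leftOp_delta_one p hω, ← hw]
  · rw [star_prod_leftOp, cs.prod_leftOp_delta_one p hω.reverse, cs.wordProd_reverse, hw]

/-- The commutation theorem: the commutants of the left and of the right Hecke operators commute.
Both `x* Ω` and `y* Ω` arise from `x Ω` and `y Ω` by the involution `f ↦ conj f(w⁻¹)`, so that
`⟨xyΩ, Ω⟩` and `⟨yxΩ, Ω⟩` are the same sum over `W`. -/
theorem commute_of_commute_rightOp_of_commute_leftOp (hM : M.IsRightAngled)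
    {x y : EllTwo W →L[ℂ] EllTwo W} (hx : ∀ s, Commute x (cs.rightOp p s))
    (hy : ∀ s, Commute y (cs.leftOp p s)) : Commute x y := by
  have key : ∀ x : EllTwo W →L[ℂ] EllTwo W, (∀ s, Commute x (cs.rightOp p s)) →
      ⟪delta 1, x (y (delta 1))⟫_ℂ = ⟪delta 1, y (x (delta 1))⟫_ℂ := by
    intro x hx
    rw [← ContinuousLinearMap.adjoint_inner_left x (y (delta 1)),
      ← ContinuousLinearMap.adjoint_inner_left y (x (delta 1)),
      ← ContinuousLinearMap.star_eq_adjoint, ← ContinuousLinearMap.star_eq_adjoint,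
      lp.inner_eq_tsum, lp.inner_eq_tsum, ← (Equiv.inv W).tsum_eq]
    refine tsum_congr fun g => ?_
    simp only [RCLike.inner_apply, Equiv.inv_apply,
      cs.star_apply_delta_one_of_commute_rightOp p hx,
      cs.star_apply_delta_one_of_commute_leftOp p hy, Complex.conj_conj, inv_inv]
    ring
  refine continuousLinearMap_ext fun w => ?_
  rw [← sub_eq_zero]
  ext v
  rw [← inner_delta_left, inner_sub_right, lp.coeFn_zero, Pi.zero_apply, sub_eq_zero]
  obtain ⟨ω, hω, hw⟩ := cs.exists_isReduced w
  obtain ⟨ω', hω', hv⟩ := cs.exists_isReduced v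
  set a := (ω.map (cs.leftOp p)).prod with ha
  set b := (ω'.map (cs.leftOp p)).prod with hb
  have hya : y (a (delta 1)) = a (y (delta 1)) :=
    ContinuousLinearMap.apply_apply_of_commute (Commute.prod_map_right hy ω) _
  have hyb : ∀ f, y (star b f) = star b (y f) := fun f => by
    rw [hb, star_prod_leftOp]
    exact ContinuousLinearMap.apply_apply_of_commute (Commute.prod_map_right hy _) f
  have hright : ∀ (s : B) (ω : List B), Commute (ω.map (cs.leftOp p)).prod (cs.rightOp p s) := by
    intro s ω
    exact (Commute.prod_map_right (fun t => (cs.commute_leftOp_rightOp p hM t s).symm) ω).symm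
  have h1 := key (star b * x * a) fun s => by
    rw [hb, star_prod_leftOp]
    exact ((hright s _).mul_left (hx s)).mul_left (hright s _)
  change ⟪delta 1, star b (x (a (y (delta 1))))⟫_ℂ = ⟪delta 1, y (star b (x (a (delta 1))))⟫_ℂ at h1
  change ⟪delta v, x (y (delta w))⟫_ℂ = ⟪delta v, y (x (delta w))⟫_ℂ
  rw [hyb, ContinuousLinearMap.star_eq_adjoint, ContinuousLinearMap.adjoint_inner_right,
    ContinuousLinearMap.adjoint_inner_right, ← hya, cs.prod_leftOp_delta_one p hω,
    cs.prod_leftOp_delta_one p hω', ← hw, ← hv] at h1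
  exact h1

end CoxeterSystem

/-! ### The doubled Coxeter system -/

open scoped Classical in
/-- The Coxeter matrix obtained by replacing each generator `s` by two generators `(s, false)` and
`(s, true)` without relation between them; the generators over `s` and `t` commute iff `s` and `t`
do. Its group is the graph product of the infinite dihedral groups `⟨(s, false), (s, true)⟩`. -/
def CoxeterMatrix.double {B : Type*} (M : CoxeterMatrix B) : CoxeterMatrix (B × Bool) where
  M a b := if a.1 = b.1 then (if a.2 = b.2 then 1 else 0) else M a.1 b.1
  isSymm := by
    ext a b
    show (if b.1 = a.1 then (if b.2 = a.2 then 1 else 0) else M b.1 a.1)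
      = if a.1 = b.1 then (if a.2 = b.2 then 1 else 0) else M a.1 b.1
    rw [M.symmetric b.1 a.1]
    simp only [eq_comm]
  diagonal a := by simp
  off_diagonal a b hab := by
    by_cases h : a.1 = b.1
    · have : a.2 ≠ b.2 := fun h' => hab (Prod.ext h h')
      simp [h, this]
    · simp only [h, if_false]
      exact M.off_diagonal _ _ h

namespace CoxeterMatrix

variable {B : Type*} (M : CoxeterMatrix B)

theorem double_of_ne {s t : B} (h : s ≠ t) (i j : Bool) : M.double (s, i) (t, j) = M s t :=
  if_neg h

theorem double_of_bool_ne (s : B) {i j : Bool} (h : i ≠ j) : M.double (s, i) (s, j) = 0 := by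
  simp [CoxeterMatrix.double, h]

variable {M}

theorem IsRightAngled.double (hM : M.IsRightAngled) : M.double.IsRightAngled := by
  rintro ⟨s, i⟩ ⟨t, j⟩ hne
  rcases eq_or_ne s t with rfl | h
  · have : i ≠ j := fun h' => hne (by rw [h'])
    exact Or.inr (M.double_of_bool_ne s this)
  · rw [M.double_of_ne h]
    exact hM s t h

end CoxeterMatrix

namespace CoxeterSystem

open EllTwo

variable {B W W' : Type*} [Group W] [Group W'] {M : CoxeterMatrix B} (cs : CoxeterSystem M W)
  (cs' : CoxeterSystem M.double W')

/-- The embedding `s ↦ (s, false)` of a right-angled Coxeter group into the doubled one. -/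
def toDouble (hM : M.IsRightAngled) : W →* W' :=
  cs.lift ⟨fun s => cs'.simple (s, false), hM.isLiftable _ (fun s => cs'.simple_mul_simple_self _)
    (fun s t h => cs'.simple_mul_simple_comm (by
      rwa [M.double_of_ne]; rintro rfl; simp at h))⟩

theorem toDouble_simple (hM : M.IsRightAngled) (s : B) :
    cs.toDouble cs' hM (cs.simple s) = cs'.simple (s, false) :=
  cs.lift_apply_simple _ s

/-- The retraction of the doubled group which kills the generators `(s, true)`. -/
def ofDouble (hM : M.IsRightAngled) : W' →* W :=
  cs'.lift ⟨fun a => if a.2 then 1 else cs.simple a.1, hM.double.isLiftable _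
    (fun a => by split_ifs <;> simp)
    (fun ⟨s, i⟩ ⟨t, j⟩ h => by
      rcases eq_or_ne s t with rfl | hst
      · rcases eq_or_ne i j with rfl | hij
        · rfl
        · rw [M.double_of_bool_ne s hij] at h; simp at h
      · rw [M.double_of_ne hst] at h
        cases i <;> cases j <;> simp [cs.simple_mul_simple_comm h])⟩

theorem ofDouble_toDouble (hM : M.IsRightAngled) (w : W) :
    cs.ofDouble cs' hM (cs.toDouble cs' hM w) = w := by
  have : (cs.ofDouble cs' hM).comp (cs.toDouble cs' hM) = MonoidHom.id W := by
    refine cs.ext_simple fun s => ?_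
    rw [MonoidHom.comp_apply, toDouble_simple, ofDouble, cs'.lift_apply_simple]
    simp
  exact DFunLike.congr_fun this w

theorem toDouble_injective (hM : M.IsRightAngled) : Function.Injective (cs.toDouble cs' hM) :=
  Function.LeftInverse.injective (cs.ofDouble_toDouble cs' hM)

theorem toDouble_wordProd (hM : M.IsRightAngled) (ω : List B) :
    cs.toDouble cs' hM (cs.wordProd ω) = cs'.wordProd (ω.map fun s => (s, false)) := by
  induction ω with
  | nil => simp
  | cons s ω ih => rw [cs.wordProd_cons, map_mul, ih, toDouble_simple, List.map_cons,
      cs'.wordProd_cons]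

theorem length_toDouble (hM : M.IsRightAngled) (w : W) :
    cs'.length (cs.toDouble cs' hM w) = cs.length w := by
  refine le_antisymm ?_ ?_
  · obtain ⟨ω, hω, rfl⟩ := cs.exists_isReduced w
    rw [toDouble_wordProd, hω.eq]
    simpa using cs'.length_wordProd_le (ω.map fun s => (s, false))
  · have key : ∀ ω : List (B × Bool),
        cs.length (cs.ofDouble cs' hM (cs'.wordProd ω)) ≤ ω.length := by
      intro ω
      induction ω with
      | nil => simp
      | cons a ω ih =>
        rw [cs'.wordProd_cons, map_mul, List.length_cons]
        refine (cs.length_mul_le _ _).trans ?_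
        have : cs.length (cs.ofDouble cs' hM (cs'.simple a)) ≤ 1 := by
          rw [ofDouble, cs'.lift_apply_simple]
          split_ifs <;> simp
        omega
    obtain ⟨ω, hω, hw⟩ := cs'.exists_isReduced (cs.toDouble cs' hM w)
    have := key ω
    rwa [← hω.eq, ← hw, ofDouble_toDouble] at this

theorem not_isLeftDescent_toDouble (hM : M.IsRightAngled) (w : W) (s : B) :
    ¬ cs'.IsLeftDescent (cs.toDouble cs' hM w) (s, true) := by
  obtain ⟨ω, hω, rfl⟩ := cs.exists_isReduced w
  intro h
  rw [toDouble_wordProd] at h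
  obtain ⟨j, hj, hje⟩ := cs'.exchange hM.double h
  rw [List.eraseIdx_map, ← cs.toDouble_wordProd cs' hM, ← cs.toDouble_wordProd cs' hM] at hje
  have h1 := congrArg (cs.ofDouble cs' hM) hje
  have h2 : cs.ofDouble cs' hM (cs'.simple (s, true)) = 1 := by
    rw [ofDouble, cs'.lift_apply_simple]; simp
  rw [map_mul, ofDouble_toDouble, ofDouble_toDouble, h2, one_mul] at h1
  rw [← h1, mul_eq_right] at hje
  have := cs'.length_simple (s, true)
  rw [hje, cs'.length_one] at this
  exact absurd this (by norm_num)

/-! ### Conjugated Hecke operators -/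

section Conjugated

variable (p : ℝ) (c d : ℝ)

/-- The parameters of the doubled system: `p` for `(s, false)` and `0` for `(s, true)`. -/
def doubleParam (p : ℝ) (a : B × Bool) : ℝ := if a.2 then 0 else p

/-- The operator `c + i d L`, with `L` the left translation by `(s, true)`. It is unitary if
`c² + d² = 1`. -/
def rotationOp (s : B) : EllTwo W' →L[ℂ] EllTwo W' :=
  (c : ℂ) • 1 + (d * Complex.I) • cs'.leftOp (doubleParam p) (s, true)

/-- The conjugate `u_s T_s u_s*` of the Hecke operator of `(s, false)` by `u_s = c + i d L`. -/
def conjOp (s : B) : EllTwo W' →L[ℂ] EllTwo W' :=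
  cs'.rotationOp p c d s * cs'.leftOp (doubleParam p) (s, false) * cs'.rotationOp p c (-d) s

theorem star_rotationOp (s : B) : star (cs'.rotationOp p c d s) = cs'.rotationOp p c (-d) s := by
  simp only [rotationOp, star_add, star_smul, star_one, (cs'.isSelfAdjoint_leftOp _ _).star_eq]
  simp

theorem rotationOp_mul {c d : ℝ} (h : c ^ 2 + d ^ 2 = 1) (s : B) :
    cs'.rotationOp p c (-d) s * cs'.rotationOp p c d s = 1 := by
  have h1 := cs'.leftOp_mul_self (doubleParam p) (s, true)
  have h2 : doubleParam p (s, true) = 0 := rfl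
  rw [h2, Complex.ofReal_zero, zero_smul, add_zero] at h1
  have h3 : (c : ℂ) ^ 2 + (d : ℂ) ^ 2 = 1 := by exact_mod_cast h
  simp only [rotationOp, mul_add, add_mul, smul_mul_smul_comm, one_mul, mul_one, h1]
  have h4 : (((-d : ℝ) : ℂ) * Complex.I * (d * Complex.I)) = (d : ℂ) ^ 2 := by
    push_cast
    linear_combination (-(d:ℂ) ^ 2) * Complex.I_sq
  rw [h4]
  match_scalars
  · linear_combination h3
  · ring

theorem isSelfAdjoint_conjOp (s : B) : IsSelfAdjoint (cs'.conjOp p c d s) := by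
  rw [IsSelfAdjoint, conjOp, star_mul, star_mul, star_rotationOp, star_rotationOp, neg_neg,
    (cs'.isSelfAdjoint_leftOp _ _).star_eq, mul_assoc]

theorem conjOp_mul_self {c d : ℝ} (h : c ^ 2 + d ^ 2 = 1) (s : B) :
    cs'.conjOp p c d s * cs'.conjOp p c d s = 1 + (p : ℂ) • cs'.conjOp p c d s := by
  have h1 := cs'.rotationOp_mul p h s
  have h2 := cs'.rotationOp_mul p (c := c) (d := -d) (by simpa using h) s
  rw [neg_neg] at h2
  have h3 := cs'.leftOp_mul_self (doubleParam p) (s, false)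
  have h4 : doubleParam p (s, false) = p := rfl
  rw [h4] at h3
  set u := cs'.rotationOp p c d s
  set v := cs'.rotationOp p c (-d) s
  set L := cs'.leftOp (doubleParam p) (s, false)
  show u * L * v * (u * L * v) = 1 + (p : ℂ) • (u * L * v)
  calc u * L * v * (u * L * v) = u * L * (v * u) * L * v := by simp only [mul_assoc]
    _ = u * (L * L) * v := by rw [h1, mul_one]; simp only [mul_assoc]
    _ = _ := by
      rw [h3, mul_add, add_mul, mul_one, h2, mul_smul_comm, smul_mul_assoc]

theorem commute_conjOp_right {x : EllTwo W' →L[ℂ] EllTwo W'} {s : B}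
    (h : ∀ i, Commute x (cs'.leftOp (doubleParam p) (s, i))) : Commute x (cs'.conjOp p c d s) := by
  have hr : ∀ d, Commute x (cs'.rotationOp p c d s) := fun d =>
    ((Commute.one_right x).smul_right _).add_right ((h true).smul_right _)
  exact ((hr d).mul_right (h false)).mul_right (hr (-d))

theorem conjOp_comm (hM : M.IsRightAngled) {s t : B} (h : M s t = 2) :
    cs'.conjOp p c d s * cs'.conjOp p c d t = cs'.conjOp p c d t * cs'.conjOp p c d s := by
  have hst : s ≠ t := by rintro rfl; simp at h
  refine cs'.commute_conjOp_right p c d fun i => ?_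
  refine (cs'.commute_conjOp_right p c d fun j => ?_).symm
  exact cs'.commute_leftOp _ hM.double (by rw [M.double_of_ne hst.symm, M.symmetric]; exact h)

/-- The right-hand analogue of `conjOp`, with the opposite sign of `d`: this is the sign for which
both operators agree at `δ_e`. -/
def rightConjOp (s : B) : EllTwo W' →L[ℂ] EllTwo W' :=
  inversionOp * cs'.conjOp p c (-d) s * inversionOp

theorem isSelfAdjoint_rightConjOp (s : B) : IsSelfAdjoint (cs'.rightConjOp p c d s) := by
  have h : star (inversionOp : EllTwo W' →L[ℂ] _) = inversionOp := isSelfAdjoint_inversionOp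
  rw [IsSelfAdjoint, rightConjOp, star_mul, star_mul, h, (cs'.isSelfAdjoint_conjOp p c _ s).star_eq,
    mul_assoc]

theorem rightConjOp_mul_self {c d : ℝ} (h : c ^ 2 + d ^ 2 = 1) (s : B) :
    cs'.rightConjOp p c d s * cs'.rightConjOp p c d s
      = 1 + (p : ℂ) • cs'.rightConjOp p c d s := by
  rw [rightConjOp, ← inversionOp_conj_mul, cs'.conjOp_mul_self p (by simpa using h), mul_add,
    add_mul, mul_one, inversionOp_mul_self, mul_smul_comm, smul_mul_assoc]

theorem commute_leftOp_rightConjOp (hM : M.IsRightAngled) (a : B × Bool) (s : B) :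
    Commute (cs'.leftOp (doubleParam p) a) (cs'.rightConjOp p c d s) := by
  have h : ∀ b, Commute (inversionOp * cs'.leftOp (doubleParam p) a * inversionOp)
      (cs'.leftOp (doubleParam p) b) := fun b =>
    (cs'.commute_leftOp_rightOp (doubleParam p) hM.double b a).symm
  have h1 := cs'.commute_conjOp_right p c (-d) (s := s) fun i => h (s, i)
  have h2 := congrArg (fun x => inversionOp * x * inversionOp) h1.eq
  have h3 : inversionOp * (inversionOp * cs'.leftOp (doubleParam p) a * inversionOp) * inversionOp
      = cs'.leftOp (doubleParam p) a := by
    simp only [mul_assoc, inversionOp_mul_self, mul_one]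
    rw [← mul_assoc, inversionOp_mul_self, one_mul]
  rwa [inversionOp_conj_mul, inversionOp_conj_mul (cs'.conjOp p c (-d) s), h3] at h2

theorem commute_conjOp_rightConjOp (hM : M.IsRightAngled) (s t : B) :
    Commute (cs'.conjOp p c d s) (cs'.rightConjOp p c d t) :=
  (cs'.commute_conjOp_right p c d fun _ => (cs'.commute_leftOp_rightConjOp p c d hM _ t).symm).symm

/-- On functions which vanish at all elements with a left descent over `s`, the operator `conjOp`
is a combination of translations. -/
theorem conjOp_apply (hM : M.IsRightAngled) {s : B} {f : EllTwo W'}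
    (hf : ∀ x i, f x ≠ 0 → ¬ cs'.IsLeftDescent x (s, i)) (x : W') :
    cs'.conjOp p c d s f x =
      c ^ 2 * f (cs'.simple (s, false) * x)
      - c * d * Complex.I * f (cs'.simple (s, true) * (cs'.simple (s, false) * x))
      + c * d * Complex.I * f (cs'.simple (s, false) * (cs'.simple (s, true) * x))
      + d ^ 2 * f (cs'.simple (s, true) * (cs'.simple (s, false) *
        (cs'.simple (s, true) * x))) := by
  classical
  have hrot : ∀ (d : ℝ) (f : EllTwo W') x, cs'.rotationOp p c d s f x
      = c * f x + d * Complex.I * f (cs'.simple (s, true) * x) := by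
    intro d f x
    have : cs'.rotationOp p c d s f x
      = c * f x + d * Complex.I * cs'.leftOp (doubleParam p) (s, true) f x := rfl
    rw [this, leftOp_apply]
    simp [doubleParam]
  -- The function `u_s* f` vanishes at all elements with left descent `(s, false)`.
  have hvanish : ∀ x, cs'.IsLeftDescent x (s, false) → cs'.rotationOp p c (-d) s f x = 0 := by
    intro x hx
    have h1 : f x = 0 := by
      by_contra h; exact hf x false h hx
    have h2 : f (cs'.simple (s, true) * x) = 0 := by
      by_contra h
      have h3 := hf _ true h
      have h4 : cs'.IsLeftDescent x (s, true) := by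
        by_contra h5
        exact h3 (by rw [cs'.isLeftDescent_iff_not_isLeftDescent_mul,
          cs'.simple_mul_simple_cancel_left]; exact h5)
      have h6 := cs'.eq_two_of_isLeftDescent hM.double (by simp) hx h4
      rw [M.double_of_bool_ne s (by simp)] at h6
      simp at h6
    rw [hrot, h1, h2]
    simp
  have hL : ∀ x, cs'.leftOp (doubleParam p) (s, false) (cs'.rotationOp p c (-d) s f) x
      = cs'.rotationOp p c (-d) s f (cs'.simple (s, false) * x) := by
    intro x
    rw [leftOp_apply]
    split_ifs with h
    · rw [hvanish x h]; simp
    · simp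
  show cs'.rotationOp p c d s (cs'.leftOp (doubleParam p) (s, false)
    (cs'.rotationOp p c (-d) s f)) x = _
  rw [hrot, hL, hL, hrot, hrot]
  push_cast
  linear_combination (-d ^ 2 * f (cs'.simple (s, true) * (cs'.simple (s, false) *
    (cs'.simple (s, true) * x)))) * Complex.I_sq

theorem conjOp_delta_one (hM : M.IsRightAngled) (s : B) :
    cs'.conjOp p c d s (delta 1) = cs'.rightConjOp p c d s (delta 1) := by
  have hone : ∀ (x : W') (i : Bool), (delta 1 : EllTwo W') x ≠ 0 →
      ¬ cs'.IsLeftDescent x (s, i) := by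
    intro x i hx
    have : x = 1 := by by_contra h; exact hx (delta_of_ne h)
    rw [this]
    exact cs'.not_isLeftDescent_one _
  have hcomm : ∀ x y : W', (delta 1 : EllTwo W') (x * y) = (delta 1 : EllTwo W') (y * x) := by
    intro x y
    by_cases h : x * y = 1
    · rw [h, mul_eq_one_comm.1 h]
    · rw [delta_of_ne h, delta_of_ne fun h' => h (mul_eq_one_comm.1 h')]
  have hinv : ∀ x : W', (delta 1 : EllTwo W') x⁻¹ = (delta 1 : EllTwo W') x := by
    intro x
    by_cases h : x = 1
    · rw [h, inv_one]
    · rw [delta_of_ne h, delta_of_ne (inv_ne_one.2 h)]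
  ext x
  have h1 : cs'.rightConjOp p c d s (delta 1) x = cs'.conjOp p c (-d) s (delta 1) x⁻¹ := by
    show cs'.conjOp p c (-d) s (inversionOp (delta 1)) x⁻¹ = _
    rw [inversionOp_delta, inv_one]
  rw [h1, cs'.conjOp_apply p c d hM hone, cs'.conjOp_apply p c (-d) hM hone]
  have e : ∀ y : W', (delta 1 : EllTwo W') (y * x⁻¹) = (delta 1 : EllTwo W') (y⁻¹ * x) := by
    intro y
    rw [← hinv, mul_inv_rev, inv_inv, hcomm]
  simp only [← mul_assoc, e, mul_inv_rev, cs'.inv_simple]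
  push_cast
  ring

end Conjugated

end CoxeterSystem

/-! ### The isometry into the doubled system -/

/-- The isometry of `ℓ²(W)` which maps the standard basis to a given orthonormal family. -/
def Orthonormal.isometry {W H : Type*} [NormedAddCommGroup H] [InnerProductSpace ℂ H]
    [CompleteSpace H] {v : W → H} (hv : Orthonormal ℂ v) : EllTwo W →ₗᵢ[ℂ] H :=
  hv.orthogonalFamily.linearIsometry

theorem Orthonormal.isometry_delta {W H : Type*} [NormedAddCommGroup H] [InnerProductSpace ℂ H]
    [CompleteSpace H] {v : W → H} (hv : Orthonormal ℂ v) (w : W) :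
    hv.isometry (EllTwo.delta w) = v w := by
  classical
  have := hv.orthogonalFamily.linearIsometry_apply_single (i := w) (1 : ℂ)
  rw [LinearIsometry.toSpanSingleton_apply, one_smul] at this
  rw [← this, EllTwo.delta, Orthonormal.isometry]

namespace CoxeterSystem

open EllTwo

variable {B W W' : Type*} [Group W] [Group W'] {M : CoxeterMatrix B} (cs : CoxeterSystem M W)
  (cs' : CoxeterSystem M.double W') (p c d : ℝ)

/-- The vector `a_{s₁} ⋯ a_{sₙ} δ_e` for a reduced expression `w = s₁ ⋯ sₙ` and the conjugated
Hecke operators `a_s`. -/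
def conjVec (w : W) : EllTwo W' :=
  ((cs.exists_isReduced w).choose.map (cs'.conjOp p c d)).prod (delta 1)

theorem conjVec_wordProd (hM : M.IsRightAngled) {ω : List B} (hω : cs.IsReduced ω) :
    cs.conjVec cs' p c d (cs.wordProd ω) = (ω.map (cs'.conjOp p c d)).prod (delta 1) := by
  have h := (cs.exists_isReduced (cs.wordProd ω)).choose_spec
  rw [conjVec, cs.prod_map_eq_of_isReduced hM (cs'.conjOp p c d)
    (fun s t => cs'.conjOp_comm p c d hM) h.1 hω h.2.symm]

theorem conjVec_one (hM : M.IsRightAngled) : cs.conjVec cs' p c d 1 = delta 1 := by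
  have : cs.IsReduced [] := by simp [IsReduced]
  simpa using cs.conjVec_wordProd cs' p c d hM this

theorem conjOp_conjVec (hM : M.IsRightAngled) {s : B} {w : W} (h : ¬ cs.IsLeftDescent w s) :
    cs'.conjOp p c d s (cs.conjVec cs' p c d w) = cs.conjVec cs' p c d (cs.simple s * w) := by
  obtain ⟨ω, hω, rfl⟩ := cs.exists_isReduced w
  have h1 : cs.IsReduced (s :: ω) := by
    unfold IsReduced
    rw [cs.wordProd_cons, (cs.not_isLeftDescent_iff).1 h, hω.eq, List.length_cons]
  rw [← cs.wordProd_cons, cs.conjVec_wordProd cs' p c d hM hω, cs.conjVec_wordProd cs' p c d hM h1,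
    List.map_cons, List.prod_cons]
  rfl

theorem rightConjOp_conjVec (hM : M.IsRightAngled) {s : B} {w : W}
    (h : ¬ cs.IsRightDescent w s) :
    cs'.rightConjOp p c d s (cs.conjVec cs' p c d w) = cs.conjVec cs' p c d (w * cs.simple s) := by
  obtain ⟨ω, hω, rfl⟩ := cs.exists_isReduced w
  have h1 : cs.IsReduced (ω ++ [s]) := by
    unfold IsReduced
    rw [cs.wordProd_append, cs.wordProd_singleton, (cs.not_isRightDescent_iff).1 h, hω.eq,
      List.length_append, List.length_singleton]
  have h2 : Commute (cs'.rightConjOp p c d s) (ω.map (cs'.conjOp p c d)).prod :=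
    Commute.prod_map_right (fun t => (cs'.commute_conjOp_rightConjOp p c d hM t s).symm) ω
  rw [← cs.wordProd_singleton, ← cs.wordProd_append, cs.conjVec_wordProd cs' p c d hM hω,
    cs.conjVec_wordProd cs' p c d hM h1, ContinuousLinearMap.apply_apply_of_commute h2,
    ← cs'.conjOp_delta_one p c d hM, List.map_append, List.prod_append, List.map_singleton,
    List.prod_singleton]
  rfl

variable {c d} in
theorem conjOp_conjVec_of_isLeftDescent (hM : M.IsRightAngled) (hcd : c ^ 2 + d ^ 2 = 1) {s : B}
    {w : W} (h : cs.IsLeftDescent w s) :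
    cs'.conjOp p c d s (cs.conjVec cs' p c d w)
      = cs.conjVec cs' p c d (cs.simple s * w) + (p : ℂ) • cs.conjVec cs' p c d w := by
  have h1 := cs.conjOp_conjVec cs' p c d hM (cs.isLeftDescent_iff_not_isLeftDescent_mul.1 h)
  rw [cs.simple_mul_simple_cancel_left] at h1
  have h2 := congrFun (congrArg DFunLike.coe (cs'.conjOp_mul_self p hcd s))
    (cs.conjVec cs' p c d (cs.simple s * w))
  change cs'.conjOp p c d s (cs'.conjOp p c d s _) = _ + (p : ℂ) • cs'.conjOp p c d s _ at h2
  rw [h1] at h2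
  exact h2

variable {c d} in
theorem rightConjOp_conjVec_of_isRightDescent (hM : M.IsRightAngled) (hcd : c ^ 2 + d ^ 2 = 1)
    {s : B} {w : W} (h : cs.IsRightDescent w s) :
    cs'.rightConjOp p c d s (cs.conjVec cs' p c d w)
      = cs.conjVec cs' p c d (w * cs.simple s) + (p : ℂ) • cs.conjVec cs' p c d w := by
  have h1 := cs.rightConjOp_conjVec cs' p c d hM (cs.isRightDescent_iff_not_isRightDescent_mul.1 h)
  rw [cs.simple_mul_simple_cancel_right] at h1
  have h2 := congrFun (congrArg DFunLike.coe (cs'.rightConjOp_mul_self p hcd s))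
    (cs.conjVec cs' p c d (w * cs.simple s))
  change cs'.rightConjOp p c d s (cs'.rightConjOp p c d s _)
    = _ + (p : ℂ) • cs'.rightConjOp p c d s _ at h2
  rw [h1] at h2
  exact h2

/-- Induction along left multiplication by generators that increase the length. -/
theorem induction_left_of_not_isLeftDescent {P : W → Prop} (one : P 1)
    (mul : ∀ w s, ¬ cs.IsLeftDescent w s → P w → P (cs.simple s * w)) (w : W) : P w := by
  induction hn : cs.length w using Nat.strong_induction_on generalizing w with
  | _ n ih =>
  by_cases hw : w = 1
  · rw [hw]; exact one
  · obtain ⟨s, hs⟩ := cs.exists_leftDescent_of_ne_one hw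
    have h1 := mul (cs.simple s * w) s (cs.isLeftDescent_iff_not_isLeftDescent_mul.1 hs)
      (ih _ (hn ▸ hs) _ rfl)
    rwa [cs.simple_mul_simple_cancel_left] at h1

/-- A left descent over `t ≠ s` of an element `x` with left descent over `s` commutes with it and
persists when the latter is removed. -/
theorem isLeftDescent_double_of_mul (hM : M.IsRightAngled) {s t : B} {i j : Bool} {y : W'}
    (hst : s ≠ t) (hy : ¬ cs'.IsLeftDescent y (s, i))
    (h : cs'.IsLeftDescent (cs'.simple (s, i) * y) (t, j)) :
    M s t = 2 ∧ cs'.IsLeftDescent y (t, j) := by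
  have h1 : cs'.IsLeftDescent (cs'.simple (s, i) * y) (s, i) := by
    rw [cs'.isLeftDescent_iff_not_isLeftDescent_mul, cs'.simple_mul_simple_cancel_left]
    exact hy
  have h2 := cs'.eq_two_of_isLeftDescent hM.double (fun h' => hst (congrArg Prod.fst h')) h1 h
  exact ⟨by rwa [M.double_of_ne hst] at h2, (cs'.isLeftDescent_simple_mul_iff hM.double h2).1 h⟩

theorem not_isLeftDescent_double_mul (hM : M.IsRightAngled) {s : B} {i j : Bool} {y : W'}
    (hij : i ≠ j) (hy : ¬ cs'.IsLeftDescent y (s, i)) :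
    ¬ cs'.IsLeftDescent (cs'.simple (s, i) * y) (s, j) := by
  intro h
  have h1 : cs'.IsLeftDescent (cs'.simple (s, i) * y) (s, i) := by
    rw [cs'.isLeftDescent_iff_not_isLeftDescent_mul, cs'.simple_mul_simple_cancel_left]
    exact hy
  have h2 := cs'.eq_two_of_isLeftDescent hM.double (by simpa using hij) h1 h
  rw [M.double_of_bool_ne s hij] at h2
  simp at h2

/-- The vector `conjVec w` is supported on elements all of whose left descents lie over left
descents of `w`. -/
theorem isLeftDescent_of_conjVec_ne_zero (hM : M.IsRightAngled) (w : W) :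
    ∀ (x : W') (t : B) (j : Bool), cs.conjVec cs' p c d w x ≠ 0 → cs'.IsLeftDescent x (t, j) →
      cs.IsLeftDescent w t := by
  induction w using cs.induction_left_of_not_isLeftDescent with
  | one =>
    intro x t j hx h
    rw [cs.conjVec_one cs' p c d hM] at hx
    have : x = 1 := by by_contra h; exact hx (delta_of_ne h)
    exact absurd (this ▸ h) (cs'.not_isLeftDescent_one _)
  | mul w s hs ih =>
    have hsupp : ∀ y i, cs.conjVec cs' p c d w y ≠ 0 → ¬ cs'.IsLeftDescent y (s, i) :=
      fun y i hy h => hs (ih y s i hy h)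
    have hssw : cs.IsLeftDescent (cs.simple s * w) s := by
      rwa [cs.isLeftDescent_iff_not_isLeftDescent_mul, cs.simple_mul_simple_cancel_left]
    intro x t j hx h
    rcases eq_or_ne s t with rfl | hst
    · exact hssw
    -- It suffices to find the descent `(t, j)` in an element of the support of `conjVec w`.
    have hfin : ∀ y, cs.conjVec cs' p c d w y ≠ 0 → M s t = 2 → cs'.IsLeftDescent y (t, j) →
        cs.IsLeftDescent (cs.simple s * w) t := fun y hy h2 h3 =>
      (cs.isLeftDescent_simple_mul_iff hM h2).2 (ih y t j hy h3)
    rw [← cs.conjOp_conjVec cs' p c d hM hs, cs'.conjOp_apply p c d hM hsupp] at hx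
    by_cases h1 : cs.conjVec cs' p c d w (cs'.simple (s, false) * x) = 0
    swap
    · have e : x = cs'.simple (s, false) * (cs'.simple (s, false) * x) := by simp
      rw [e] at h
      have := cs'.isLeftDescent_double_of_mul hM hst (hsupp _ false h1) h
      exact hfin _ h1 this.1 this.2
    by_cases h2 : cs.conjVec cs' p c d w (cs'.simple (s, true) * (cs'.simple (s, false) * x)) = 0
    swap
    · have e : x = cs'.simple (s, false) * (cs'.simple (s, true) * (cs'.simple (s, true) *
        (cs'.simple (s, false) * x))) := by simp
      rw [e] at h
      have g1 := cs'.not_isLeftDescent_double_mul hM (j := false) (by simp) (hsupp _ true h2)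
      have g2 := cs'.isLeftDescent_double_of_mul hM hst g1 h
      exact hfin _ h2 g2.1 (cs'.isLeftDescent_double_of_mul hM hst (hsupp _ true h2) g2.2).2
    by_cases h3 : cs.conjVec cs' p c d w (cs'.simple (s, false) * (cs'.simple (s, true) * x)) = 0
    swap
    · have e : x = cs'.simple (s, true) * (cs'.simple (s, false) * (cs'.simple (s, false) *
        (cs'.simple (s, true) * x))) := by simp
      rw [e] at h
      have g1 := cs'.not_isLeftDescent_double_mul hM (j := true) (by simp) (hsupp _ false h3)
      have g2 := cs'.isLeftDescent_double_of_mul hM hst g1 h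
      exact hfin _ h3 g2.1 (cs'.isLeftDescent_double_of_mul hM hst (hsupp _ false h3) g2.2).2
    by_cases h4 : cs.conjVec cs' p c d w (cs'.simple (s, true) * (cs'.simple (s, false) *
        (cs'.simple (s, true) * x))) = 0
    · rw [h1, h2, h3, h4] at hx
      simp at hx
    · have e : x = cs'.simple (s, true) * (cs'.simple (s, false) * (cs'.simple (s, true) *
        (cs'.simple (s, true) * (cs'.simple (s, false) * (cs'.simple (s, true) * x))))) := by simp
      rw [e] at h
      have g1 := cs'.not_isLeftDescent_double_mul hM (j := false) (by simp) (hsupp _ true h4)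
      have g2 := cs'.not_isLeftDescent_double_mul hM (j := true) (by simp) g1
      have g3 := cs'.isLeftDescent_double_of_mul hM hst g2 h
      have g4 := cs'.isLeftDescent_double_of_mul hM hst g1 g3.2
      exact hfin _ h4 g3.1 (cs'.isLeftDescent_double_of_mul hM hst (hsupp _ true h4) g4.2).2

open scoped Classical in
/-- The component of `conjVec w` in `ℓ²(W)` is `c^{2|w|} δ_w`: each conjugated Hecke operator
contributes the square of the coefficient of the identity in its unitary. -/
theorem conjVec_toDouble (hM : M.IsRightAngled) (w u : W) :
    cs.conjVec cs' p c d w (cs.toDouble cs' hM u)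
      = if u = w then ((c : ℂ) ^ 2) ^ cs.length w else 0 := by
  induction w using cs.induction_left_of_not_isLeftDescent generalizing u with
  | one =>
    rw [cs.conjVec_one cs' p c d hM, delta_apply]
    simp only [map_eq_one_iff _ (cs.toDouble_injective cs' hM), cs.length_one, pow_zero]
  | mul w s hs ih =>
    have hsupp : ∀ y i, cs.conjVec cs' p c d w y ≠ 0 → ¬ cs'.IsLeftDescent y (s, i) :=
      fun y i hy h => hs (cs.isLeftDescent_of_conjVec_ne_zero cs' p c d hM w y s i hy h)
    have hzero : ∀ y i, cs'.IsLeftDescent y (s, i) → cs.conjVec cs' p c d w y = 0 :=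
      fun y i h => by by_contra hy; exact hsupp y i hy h
    have hdesc : ∀ y i, ¬ cs'.IsLeftDescent y (s, i) →
        cs'.IsLeftDescent (cs'.simple (s, i) * y) (s, i) := fun y i h => by
      rwa [cs'.isLeftDescent_iff_not_isLeftDescent_mul, cs'.simple_mul_simple_cancel_left]
    have g1 := cs.not_isLeftDescent_toDouble cs' hM u s
    have g2 := cs'.not_isLeftDescent_double_mul hM (j := false) (by simp) g1
    have g3 := cs'.not_isLeftDescent_double_mul hM (j := true) (by simp) g2
    have g4 := cs.not_isLeftDescent_toDouble cs' hM (cs.simple s * u) s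
    rw [map_mul, toDouble_simple] at g4
    -- Of the four translates in `conjOp_apply`, only the first meets the subgroup `W`: the others
    -- have a left descent over `s`.
    rw [← cs.conjOp_conjVec cs' p c d hM hs, cs'.conjOp_apply p c d hM hsupp,
      hzero _ _ (hdesc _ _ g4), hzero _ _ (hdesc _ _ g2), hzero _ _ (hdesc _ _ g3),
      ← cs.toDouble_simple cs' hM, ← map_mul, ih]
    have e : cs.simple s * u = w ↔ u = cs.simple s * w := by
      constructor <;> rintro rfl <;> simp
    simp only [e, mul_zero, sub_zero, add_zero]
    split_ifs
    · rw [(cs.not_isLeftDescent_iff).1 hs, pow_succ _ (cs.length w), mul_comm]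
    · simp

variable {c d} in
open scoped Classical in
/-- The vectors `conjVec w` satisfy the relations of the basis vectors `δ_w` under the self-adjoint
operators `conjOp`, which reduces their inner products to those with `conjVec 1 = δ_e`. -/
theorem orthonormal_conjVec (hM : M.IsRightAngled) (hcd : c ^ 2 + d ^ 2 = 1) :
    Orthonormal ℂ (cs.conjVec cs' p c d) := by
  rw [orthonormal_iff_ite]
  intro v w
  have hsymm : ∀ (s : B) (f g : EllTwo W'),
      ⟪cs'.conjOp p c d s f, g⟫_ℂ = ⟪f, cs'.conjOp p c d s g⟫_ℂ := fun s =>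
    (ContinuousLinearMap.isSelfAdjoint_iff_isSymmetric.1 (cs'.isSelfAdjoint_conjOp p c d s))
  induction v using cs.induction_left_of_not_isLeftDescent generalizing w with
  | one =>
    rw [cs.conjVec_one cs' p c d hM, inner_delta_left]
    have := cs.conjVec_toDouble cs' p c d hM w 1
    rw [map_one] at this
    rw [this]
    split_ifs with h
    · rw [← h]; simp
    · rfl
  | mul v s hs ih =>
    have e : v = cs.simple s * w ↔ cs.simple s * v = w := by
      constructor <;> rintro rfl <;> simp
    rw [← cs.conjOp_conjVec cs' p c d hM hs, hsymm]
    by_cases h : cs.IsLeftDescent w s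
    · have hvw : v ≠ w := by rintro rfl; exact hs h
      rw [cs.conjOp_conjVec_of_isLeftDescent cs' p hM hcd h, inner_add_right, inner_smul_right,
        ih, ih, if_neg hvw, mul_zero, add_zero]
      simp only [e]
    · rw [cs.conjOp_conjVec cs' p c d hM h, ih]
      simp only [e]

variable {c d} in
/-- The isometry `T_w δ_e ↦ a_w δ_e`, with `a_w` the product of the conjugated Hecke operators. -/
def conjIsometry (hM : M.IsRightAngled) (hcd : c ^ 2 + d ^ 2 = 1) :
    EllTwo W →L[ℂ] EllTwo W' :=
  (cs.orthonormal_conjVec cs' p hM hcd).isometry.toContinuousLinearMap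

variable {c d} in
theorem conjIsometry_delta (hM : M.IsRightAngled) (hcd : c ^ 2 + d ^ 2 = 1) (w : W) :
    cs.conjIsometry cs' p hM hcd (delta w) = cs.conjVec cs' p c d w :=
  (cs.orthonormal_conjVec cs' p hM hcd).isometry_delta w

theorem rightOp_delta_of_not_isRightDescent {p : B → ℝ} {s : B} {w : W}
    (h : ¬ cs.IsRightDescent w s) :
    cs.rightOp p s (delta w) = delta (w * cs.simple s) := by
  show inversionOp (cs.leftOp p s (inversionOp (delta w))) = _
  rw [inversionOp_delta, leftOp_delta_of_not_isLeftDescent, inversionOp_delta]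
  · simp
  · rwa [cs.isLeftDescent_inv_iff]

theorem rightOp_delta_of_isRightDescent {p : B → ℝ} {s : B} {w : W}
    (h : cs.IsRightDescent w s) :
    cs.rightOp p s (delta w) = delta (w * cs.simple s) + (p s : ℂ) • delta w := by
  have h1 := cs.rightOp_delta_of_not_isRightDescent (p := p)
    (cs.isRightDescent_iff_not_isRightDescent_mul.1 h)
  rw [cs.simple_mul_simple_cancel_right] at h1
  have h2 : cs.rightOp p s * cs.rightOp p s = 1 + (p s : ℂ) • cs.rightOp p s := by
    rw [rightOp, ← inversionOp_conj_mul, cs.leftOp_mul_self, mul_add, add_mul, mul_one,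
      inversionOp_mul_self, mul_smul_comm, smul_mul_assoc]
  have h3 := congrFun (congrArg DFunLike.coe h2) (delta (w * cs.simple s))
  change cs.rightOp p s (cs.rightOp p s _) = _ + (p s : ℂ) • cs.rightOp p s _ at h3
  rw [h1] at h3
  exact h3

variable {c d} in
/-- The isometry is a map of right Hecke modules. -/
theorem conjIsometry_rightOp (hM : M.IsRightAngled) (hcd : c ^ 2 + d ^ 2 = 1) (s : B) :
    cs.conjIsometry cs' p hM hcd ∘L cs.rightOp (fun _ => p) s
      = cs'.rightConjOp p c d s ∘L cs.conjIsometry cs' p hM hcd := by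
  refine continuousLinearMap_ext fun w => ?_
  simp only [ContinuousLinearMap.comp_apply, conjIsometry_delta]
  by_cases h : cs.IsRightDescent w s
  · rw [cs.rightOp_delta_of_isRightDescent h,
      cs.rightConjOp_conjVec_of_isRightDescent cs' p hM hcd h, map_add, map_smul,
      conjIsometry_delta, conjIsometry_delta]
  · rw [cs.rightOp_delta_of_not_isRightDescent h, cs.rightConjOp_conjVec cs' p c d hM h,
      conjIsometry_delta]

/-! ### The doubled space as a multiple of `ℓ²(W)` -/

/-- Representatives of minimal length for the cosets of `W` in the doubled group. -/
theorem exists_minimal_coset_representative (hM : M.IsRightAngled) :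
    ∃ g : W' → W', (∀ u x, g (cs.toDouble cs' hM u * x) = g x) ∧
      ∀ x, ∃ u, x = cs.toDouble cs' hM u * g x ∧
        ∀ v, cs'.length (g x) ≤ cs'.length (cs.toDouble cs' hM v * g x) := by
  classical
  let rel : Setoid W' :=
    { r := fun x y => ∃ u, x = cs.toDouble cs' hM u * y
      iseqv :=
        ⟨fun x => ⟨1, by simp⟩,
          fun {x y} ⟨u, hu⟩ => ⟨u⁻¹, by rw [hu, map_inv, inv_mul_cancel_left]⟩,
          fun {x y z} ⟨u, hu⟩ ⟨v, hv⟩ => ⟨u * v, by rw [hu, hv, map_mul, mul_assoc]⟩⟩ }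
  have hmin : ∀ a : Quotient rel, ∃ y : W', Quotient.mk rel y = a ∧
      ∀ z : W', Quotient.mk rel z = a → cs'.length y ≤ cs'.length z := by
    intro a
    have hex : ∃ n, ∃ y : W', Quotient.mk rel y = a ∧ cs'.length y = n := by
      obtain ⟨y, hy⟩ := Quotient.exists_rep a
      exact ⟨_, y, hy, rfl⟩
    obtain ⟨y, hy, hn⟩ := Nat.find_spec hex
    exact ⟨y, hy, fun z hz => hn ▸ Nat.find_min' hex ⟨z, hz, rfl⟩⟩
  choose rep hrep hrepmin using hmin
  refine ⟨fun x => rep (Quotient.mk rel x), fun u x => ?_, fun x => ?_⟩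
  · have : Quotient.mk rel (cs.toDouble cs' hM u * x) = Quotient.mk rel x :=
      Quotient.sound ⟨u, rfl⟩
    show rep _ = rep _
    rw [this]
  · obtain ⟨u, hu⟩ : rel.r x (rep (Quotient.mk rel x)) :=
      rel.symm (Quotient.exact (hrep (Quotient.mk rel x)))
    refine ⟨u, hu, fun v => hrepmin _ _ ?_⟩
    have h1 : Quotient.mk rel (cs.toDouble cs' hM v * rep (Quotient.mk rel x))
        = Quotient.mk rel (rep (Quotient.mk rel x)) := Quotient.sound ⟨v, rfl⟩
    exact h1.trans (hrep _)

/-- The left descents over `W` of `u g`, with `g` of minimal length in its coset, are those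
of `u`. -/
theorem isLeftDescent_toDouble_mul_iff (hM : M.IsRightAngled) {g : W'}
    (hg : ∀ v, cs'.length g ≤ cs'.length (cs.toDouble cs' hM v * g)) (u : W) (s : B) :
    cs'.IsLeftDescent (cs.toDouble cs' hM u * g) (s, false) ↔ cs.IsLeftDescent u s := by
  have key : ∀ u, ¬ cs.IsLeftDescent u s →
      ¬ cs'.IsLeftDescent (cs.toDouble cs' hM u * g) (s, false) := by
    intro u hu h
    obtain ⟨ω, hω, rfl⟩ := cs.exists_isReduced u
    obtain ⟨γ, hγ, rfl⟩ := cs'.exists_isReduced g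
    rw [toDouble_wordProd, ← cs'.wordProd_append] at h
    obtain ⟨j, hj, hje⟩ := cs'.exchange hM.double h
    rcases lt_or_ge j ω.length with hlt | hge
    · rw [List.eraseIdx_append_of_lt_length (by simpa using hlt), cs'.wordProd_append,
        cs'.wordProd_append, ← mul_assoc, mul_left_inj, List.eraseIdx_map,
        ← cs.toDouble_wordProd cs' hM, ← cs.toDouble_wordProd cs' hM,
        ← cs.toDouble_simple cs' hM, ← map_mul] at hje
      have h1 := cs.toDouble_injective cs' hM hje
      have h2 := cs.length_wordProd_le (ω.eraseIdx j)
      rw [← h1, (cs.not_isLeftDescent_iff).1 hu, hω.eq, List.length_eraseIdx_of_lt hlt] at h2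
      omega
    · rw [List.eraseIdx_append_of_length_le (by simpa using hge), cs'.wordProd_append,
        cs'.wordProd_append, ← cs.toDouble_wordProd cs' hM, ← cs.toDouble_simple cs' hM] at hje
      have h1 := hg ((cs.wordProd ω)⁻¹ * (cs.simple s * cs.wordProd ω))
      rw [map_mul, map_inv, map_mul, mul_assoc, mul_assoc, hje, inv_mul_cancel_left, hγ.eq] at h1
      have h2 := cs'.length_wordProd_le (γ.eraseIdx (j - (ω.map fun s => (s, false)).length))
      rw [List.length_append, List.length_map] at hj
      rw [List.length_eraseIdx_of_lt (by rw [List.length_map]; omega)] at h2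
      omega
  refine ⟨fun h => by by_contra hu; exact key u hu h, fun h => ?_⟩
  have h1 := key (cs.simple s * u) (cs.isLeftDescent_iff_not_isLeftDescent_mul.1 h)
  rw [map_mul, toDouble_simple, mul_assoc] at h1
  exact cs'.isLeftDescent_iff_not_isLeftDescent_mul.2 h1

end CoxeterSystem

/-! ### Amplifications and the bicommutant -/

section Amplification

variable {H : Type*} [NormedAddCommGroup H] [InnerProductSpace ℂ H] (ι : Type*)

/-- The Hilbert sum of copies of `H` indexed by `ι`. -/
abbrev HilbertMultiple (ι H : Type*) [NormedAddCommGroup H] : Type _ := lp (fun _ : ι => H) 2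

theorem HilbertMultiple.summable_sq_norm {ι H : Type*} [NormedAddCommGroup H]
    (f : HilbertMultiple ι H) :
    Summable fun i => ‖f i‖ ^ 2 := by
  simpa using (memℓp_gen_iff (by norm_num : 0 < (2 : ℝ≥0∞).toReal)).1 (lp.memℓp f)

theorem HilbertMultiple.tsum_sq_norm {ι H : Type*} [NormedAddCommGroup H]
    (f : HilbertMultiple ι H) :
    ∑' i, ‖f i‖ ^ 2 = ‖f‖ ^ 2 := by
  have := lp.norm_rpow_eq_tsum (by norm_num : 0 < (2 : ℝ≥0∞).toReal) f
  simpa using this.symm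

/-- The amplification `x ⊗ 1` of `x`, acting diagonally on a Hilbert sum of copies of `H`. -/
def amplify (x : H →L[ℂ] H) : HilbertMultiple ι H →L[ℂ] HilbertMultiple ι H :=
  have h2 : 0 < (2 : ℝ≥0∞).toReal := by norm_num
  have hle : ∀ (f : HilbertMultiple ι H) i, ‖x (f i)‖ ^ (2 : ℝ≥0∞).toReal
      ≤ ‖x‖ ^ (2 : ℝ≥0∞).toReal * ‖f i‖ ^ (2 : ℝ≥0∞).toReal := fun f i => by
    rw [← Real.mul_rpow (norm_nonneg _) (norm_nonneg _)]
    exact Real.rpow_le_rpow (norm_nonneg _) (x.le_opNorm _) h2.le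
  have hsum : ∀ f : HilbertMultiple ι H,
      Summable fun i => ‖x‖ ^ (2 : ℝ≥0∞).toReal * ‖f i‖ ^ (2 : ℝ≥0∞).toReal := fun f =>
    ((memℓp_gen_iff h2).1 (lp.memℓp f)).mul_left _
  have hsum' : ∀ f : HilbertMultiple ι H, Summable fun i => ‖x (f i)‖ ^ (2 : ℝ≥0∞).toReal :=
    fun f => Summable.of_nonneg_of_le (fun _ => by positivity) (hle f) (hsum f)
  LinearMap.mkContinuous
    { toFun := fun f => ⟨fun i => x (f i), (memℓp_gen_iff h2).2 (hsum' f)⟩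
      map_add' := fun f g => by
        ext i
        exact map_add x (f i) (g i)
      map_smul' := fun c f => by
        ext i
        exact map_smul x c (f i) } ‖x‖
    (fun f => by
      refine lp.norm_le_of_tsum_le h2 (by positivity) ?_
      rw [Real.mul_rpow (norm_nonneg _) (norm_nonneg _), lp.norm_rpow_eq_tsum h2, ← tsum_mul_left]
      exact (hsum' f).tsum_le_tsum (hle f) (hsum f))

variable {ι}

theorem ContinuousLinearMap.summable_inner_of_summable_sq (x : H →L[ℂ] H) {ξ η : ι → H}
    (hξ : Summable fun i => ‖ξ i‖ ^ 2) (hη : Summable fun i => ‖η i‖ ^ 2) :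
    Summable fun i => ⟪η i, x (ξ i)⟫_ℂ := by
  refine Summable.of_norm_bounded ((hξ.add hη).mul_left ‖x‖) fun i => ?_
  calc ‖⟪η i, x (ξ i)⟫_ℂ‖ ≤ ‖η i‖ * (‖x‖ * ‖ξ i‖) :=
        (norm_inner_le_norm _ _).trans (by gcongr; exact x.le_opNorm _)
    _ = ‖x‖ * (‖ξ i‖ * ‖η i‖) := by ring
    _ ≤ ‖x‖ * (‖ξ i‖ ^ 2 + ‖η i‖ ^ 2) := by
        gcongr
        nlinarith [sq_nonneg (‖ξ i‖ - ‖η i‖), sq_nonneg ‖ξ i‖, sq_nonneg ‖η i‖]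

@[simp]
theorem amplify_apply (x : H →L[ℂ] H) (f : HilbertMultiple ι H) (i : ι) :
    amplify ι x f i = x (f i) := rfl

theorem amplify_mul (x y : H →L[ℂ] H) : amplify ι (x * y) = amplify ι x * amplify ι y := rfl

theorem amplify_add (x y : H →L[ℂ] H) : amplify ι (x + y) = amplify ι x + amplify ι y := rfl

theorem amplify_smul (c : ℂ) (x : H →L[ℂ] H) : amplify ι (c • x) = c • amplify ι x := rfl

open scoped Classical in
theorem amplify_single (x : H →L[ℂ] H) (i : ι) (h : H) :
    amplify ι x (lp.single 2 i h) = lp.single 2 i (x h) := by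
  ext j
  rw [amplify_apply, lp.single_apply, lp.single_apply]
  by_cases hj : j = i
  · subst hj; simp
  · simp [hj]

/-- An operator which commutes with the amplifications of a set of operators commutes with the
amplifications of its bicommutant: the matrix entries of the operator lie in the commutant. -/
theorem commute_amplify_of_bicommutant {S : Set (H →L[ℂ] H)} {x : H →L[ℂ] H}
    (hx : ∀ y, (∀ a ∈ S, Commute y a) → Commute y x)
    {T : HilbertMultiple ι H →L[ℂ] HilbertMultiple ι H}
    (hT : ∀ a ∈ S, Commute T (amplify ι a)) : Commute T (amplify ι x) := by
  classical
  have key : ∀ i j, Commute (lp.evalCLM ℂ (fun _ : ι => H) 2 i ∘L T ∘L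
      lp.singleContinuousLinearMap ℂ (fun _ : ι => H) 2 j) x := by
    refine fun i j => hx _ fun a ha => ?_
    ext h
    show T (lp.single 2 j (a h)) i = a (T (lp.single 2 j h) i)
    rw [← amplify_single, ContinuousLinearMap.apply_apply_of_commute (hT a ha), amplify_apply]
  ext f i
  show T (amplify ι x f) i = x (T f i)
  have h1 := (lp.hasSum_single (by norm_num : (2 : ℝ≥0∞) ≠ ⊤) f)
  have h2 := h1.mapL ((lp.evalCLM ℂ (fun _ : ι => H) 2 i) ∘L T ∘L amplify ι x)
  have h3 := h1.mapL (x ∘L (lp.evalCLM ℂ (fun _ : ι => H) 2 i) ∘L T)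
  refine h2.unique (Eq.subst (motive := fun g => HasSum g _) (funext fun j => ?_) h3)
  show x (T (lp.single 2 j (f j)) i) = T (amplify ι x (lp.single 2 j (f j))) i
  rw [amplify_single]
  exact (congrFun (congrArg DFunLike.coe (key i j).eq) (f j)).symm

variable [CompleteSpace H]

theorem amplify_star (x : H →L[ℂ] H) : amplify ι (star x) = star (amplify ι x) := by
  refine (ContinuousLinearMap.eq_adjoint_iff _ _).2 fun f g => ?_
  rw [lp.inner_eq_tsum, lp.inner_eq_tsum]
  refine tsum_congr fun i => ?_
  rw [amplify_apply, amplify_apply, ContinuousLinearMap.star_eq_adjoint,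
    ContinuousLinearMap.adjoint_inner_left]

/-- The bicommutant theorem for a single vector. -/
theorem exists_norm_sub_lt_of_bicommutant {S : Set (H →L[ℂ] H)} (hS : ∀ a ∈ S, star a ∈ S)
    (A : Submodule ℂ (H →L[ℂ] H)) (hone : 1 ∈ A) (hmul : ∀ a ∈ S, ∀ b ∈ A, a * b ∈ A)
    {x : H →L[ℂ] H} (hx : ∀ y, (∀ a ∈ S, Commute y a) → Commute y x) (ξ : H) {ε : ℝ}
    (hε : 0 < ε) : ∃ a ∈ A, ‖x ξ - a ξ‖ < ε := by
  let K : Submodule ℂ H :=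
    (A.map (ContinuousLinearMap.apply ℂ H ξ).toLinearMap).topologicalClosure
  have hK : IsClosed (K : Set H) := Submodule.isClosed_topologicalClosure _
  have : CompleteSpace K := hK.completeSpace_coe
  have hinv : ∀ a ∈ S, ∀ f ∈ K, a f ∈ K := by
    intro a ha f hf
    have h1 : A.map (ContinuousLinearMap.apply ℂ H ξ).toLinearMap ≤ K.comap a.toLinearMap := by
      rintro _ ⟨b, hb, rfl⟩
      exact Submodule.le_topologicalClosure _ ⟨a * b, hmul a ha b hb, rfl⟩
    exact Submodule.topologicalClosure_minimal _ h1 (hK.preimage a.continuous) hf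
  have hcomm : ∀ a ∈ S, Commute K.starProjection a := by
    intro a ha
    ext f
    show K.starProjection (a f) = a (K.starProjection f)
    refine Submodule.eq_starProjection_of_mem_of_inner_eq_zero
      (hinv a ha _ (Submodule.starProjection_apply_mem K f)) fun g hg => ?_
    rw [← map_sub, ← ContinuousLinearMap.adjoint_inner_right, ← ContinuousLinearMap.star_eq_adjoint]
    exact Submodule.starProjection_inner_eq_zero f _ (hinv _ (hS a ha) g hg)
  have hξ : ξ ∈ K := Submodule.le_topologicalClosure _ ⟨1, hone, rfl⟩
  have hxξ : x ξ ∈ K := by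
    rw [← Submodule.starProjection_eq_self_iff,
      ContinuousLinearMap.apply_apply_of_commute (hx _ hcomm),
      Submodule.starProjection_eq_self_iff.2 hξ]
  obtain ⟨_, ⟨a, ha, rfl⟩, hlt⟩ := Metric.mem_closure_iff.1 hxξ ε hε
  exact ⟨a, ha, by rw [← dist_eq_norm]; exact hlt⟩

/-- The bicommutant theorem for finitely many vectors in a Hilbert sum of copies of `H`: density in
the `σ`-strong topology. -/
theorem exists_forall_norm_amplify_sub_lt {κ : Type*} {S : Set (H →L[ℂ] H)}
    (hS : ∀ a ∈ S, star a ∈ S) (A : Submodule ℂ (H →L[ℂ] H)) (hone : 1 ∈ A)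
    (hmul : ∀ a ∈ S, ∀ b ∈ A, a * b ∈ A) {x : H →L[ℂ] H}
    (hx : ∀ y, (∀ a ∈ S, Commute y a) → Commute y x) (F : Finset (HilbertMultiple κ H)) {ε : ℝ}
    (hε : 0 < ε) : ∃ a ∈ A, ∀ ξ ∈ F, ‖amplify κ x ξ - amplify κ a ξ‖ < ε := by
  let Ξ : HilbertMultiple F (HilbertMultiple κ H) := ⟨fun ξ => ξ, Memℓp.all _⟩
  let α : (H →L[ℂ] H) →ₗ[ℂ] (HilbertMultiple F (HilbertMultiple κ H) →L[ℂ] _) :=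
    { toFun := fun a => amplify F (amplify κ a)
      map_add' := fun _ _ => rfl
      map_smul' := fun _ _ => rfl }
  obtain ⟨_, ⟨a, ha, rfl⟩, hlt⟩ := exists_norm_sub_lt_of_bicommutant (S := α '' S)
    (by rintro _ ⟨a, ha, rfl⟩
        exact ⟨star a, hS a ha, by
          show amplify F (amplify κ (star a)) = star (amplify F (amplify κ a))
          rw [amplify_star, amplify_star]⟩)
    (A.map α) ⟨1, hone, rfl⟩
    (by rintro _ ⟨a, ha, rfl⟩ _ ⟨b, hb, rfl⟩
        exact ⟨a * b, hmul a ha b hb, rfl⟩) (x := α x)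
    (fun T hT => commute_amplify_of_bicommutant (S := amplify κ '' S)
      (fun y hy => commute_amplify_of_bicommutant hx fun a ha => hy _ ⟨a, ha, rfl⟩)
      (by rintro _ ⟨a, ha, rfl⟩; exact hT _ ⟨a, ha, rfl⟩)) Ξ hε
  refine ⟨a, ha, fun ξ hξ => lt_of_le_of_lt ?_ hlt⟩
  exact lp.norm_apply_le_norm (by norm_num) (α x Ξ - α a Ξ) (⟨ξ, hξ⟩ : F)

end Amplification

namespace VonNeumannAlgebra

variable {H : Type*} [NormedAddCommGroup H] [InnerProductSpace ℂ H] [CompleteSpace H]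

/-- Membership in the generated von Neumann algebra of a set of self-adjoint operators. -/
theorem mem_generatedBy_iff {X : Set (H →L[ℂ] H)} (hX : ∀ a ∈ X, IsSelfAdjoint a)
    {x : H →L[ℂ] H} : x ∈ generatedBy X ↔ ∀ y, (∀ a ∈ X, Commute y a) → Commute y x := by
  have h1 : ∀ y, y ∈ StarSubalgebra.centralizer ℂ X ↔ ∀ a ∈ X, Commute y a := by
    intro y
    rw [StarSubalgebra.mem_centralizer_iff]
    refine forall₂_congr fun a ha => ?_
    rw [(hX a ha).star_eq, and_self]
    exact eq_comm
  have h2 : x ∈ generatedBy X ↔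
      x ∈ StarSubalgebra.centralizer ℂ (StarSubalgebra.centralizer ℂ X : Set (H →L[ℂ] H)) :=
    Iff.rfl
  rw [h2, StarSubalgebra.mem_centralizer_iff]
  constructor
  · intro h y hy
    exact (h y ((h1 y).2 hy)).1
  · intro h y hy
    exact ⟨h y ((h1 y).1 hy), h (star y) ((h1 _).1 (star_mem hy))⟩

theorem subset_generatedBy (X : Set (H →L[ℂ] H)) : X ⊆ generatedBy X := by
  intro x hx
  change x ∈ StarSubalgebra.centralizer ℂ _
  rw [StarSubalgebra.mem_centralizer_iff]
  intro y hy
  have h := (StarSubalgebra.mem_centralizer_iff ℂ).1 hy _ hx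
  refine ⟨h.1.symm, ?_⟩
  have h' := congrArg star h.2
  rw [star_mul, star_mul, star_star] at h'
  exact h'

theorem generatedBy_subset {X : Set (H →L[ℂ] H)} {N : VonNeumannAlgebra H}
    (h : X ⊆ (N : Set (H →L[ℂ] H))) : (generatedBy X : Set (H →L[ℂ] H)) ⊆ N := by
  intro x hx
  rw [← N.centralizer_centralizer]
  intro y hy
  refine ((StarSubalgebra.mem_centralizer_iff ℂ).1 hx y ?_).1
  refine (StarSubalgebra.mem_centralizer_iff ℂ).2 fun a ha => ⟨hy a (h ha), ?_⟩
  exact hy (star a) (star_mem (h ha))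

/-! ### Normal maps -/

/-- Sums of vector functionals over an arbitrary index set are `σ`-weakly continuous: only
countably many summands are non-zero. -/
theorem continuous_tsum_inner {ι : Type*} (N : VonNeumannAlgebra H) {ξ η : ι → H}
    (hξ : Summable fun i => ‖ξ i‖ ^ 2) (hη : Summable fun i => ‖η i‖ ^ 2) :
    @Continuous N ℂ N.ultraweakTopology _ fun x => ∑' i, ⟪η i, (x : H →L[ℂ] H) (ξ i)⟫_ℂ := by
  let s : Set ι := Function.support fun i => ‖ξ i‖ ^ 2
  have hs : s.Countable := hξ.countable_support
  have : Countable s := hs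
  obtain ⟨e, he⟩ := exists_injective_nat s
  have hext : ∀ f : ι → H, (Summable fun i => ‖f i‖ ^ 2) →
      Summable fun n => ‖Function.extend e (fun i : s => f i) 0 n‖ ^ 2 := by
    intro f hf
    have h1 : (fun n => ‖Function.extend e (fun i : s => f i) 0 n‖ ^ 2)
        = Function.extend e (fun i : s => ‖f i‖ ^ 2) 0 := by
      funext n
      by_cases hn : ∃ i, e i = n
      · obtain ⟨i, rfl⟩ := hn
        rw [he.extend_apply, he.extend_apply]
      · rw [Function.extend_apply' _ _ _ hn, Function.extend_apply' _ _ _ hn]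
        simp
    rw [h1, summable_extend_zero he]
    exact hf.subtype s
  have hsum : ∀ x : N, ∑' i, ⟪η i, (x : H →L[ℂ] H) (ξ i)⟫_ℂ
      = ∑' n, ⟪Function.extend e (fun i : s => η i) 0 n,
        (x : H →L[ℂ] H) (Function.extend e (fun i : s => ξ i) 0 n)⟫_ℂ := by
    intro x
    have h1 : (fun n => ⟪Function.extend e (fun i : s => η i) 0 n,
        (x : H →L[ℂ] H) (Function.extend e (fun i : s => ξ i) 0 n)⟫_ℂ)
        = Function.extend e (fun i : s => ⟪η i, (x : H →L[ℂ] H) (ξ i)⟫_ℂ) 0 := by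
      funext n
      by_cases hn : ∃ i, e i = n
      · obtain ⟨i, rfl⟩ := hn
        rw [he.extend_apply, he.extend_apply, he.extend_apply]
      · rw [Function.extend_apply' _ _ _ hn, Function.extend_apply' _ _ _ hn,
          Function.extend_apply' _ _ _ hn]
        simp
    rw [h1, tsum_extend_zero he,
      tsum_subtype_eq_of_support_subset (f := fun i => ⟪η i, (x : H →L[ℂ] H) (ξ i)⟫_ℂ) (s := s)]
    intro i hi
    by_contra hi'
    have : ξ i = 0 := by simpa [s] using hi'
    simp [this] at hi
  have h3 : (fun x : N => ∑' i, ⟪η i, (x : H →L[ℂ] H) (ξ i)⟫_ℂ) = _ := funext hsum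
  rw [h3, continuous_iff_le_induced]
  exact iInf_le_of_le _ (iInf_le_of_le _ (iInf_le_of_le (hext ξ hξ) (iInf_le _ (hext η hη))))

theorem continuous_inner (N : VonNeumannAlgebra H) (ξ η : H) :
    @Continuous N ℂ N.ultraweakTopology _ fun x => ⟪η, (x : H →L[ℂ] H) ξ⟫_ℂ := by
  have := N.continuous_tsum_inner (ξ := fun _ : Unit => ξ) (η := fun _ : Unit => η)
    Summable.of_finite Summable.of_finite
  simpa only [tsum_fintype, Finset.univ_unique, Finset.sum_singleton] using this

/-- Compressions of amplifications are normal. -/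
theorem isNormalMap_of_eq_compression {ι : Type*} {N₁ N₂ : VonNeumannAlgebra H}
    (V : H →L[ℂ] HilbertMultiple ι H) (Φ : N₁ →ₗ[ℂ] N₂)
    (hΦ : ∀ x : N₁, (Φ x : H →L[ℂ] H)
      = ContinuousLinearMap.adjoint V ∘L amplify ι (x : H →L[ℂ] H) ∘L V) :
    IsNormalMap N₁ N₂ Φ := by
  have hV : ∀ ξ : ℕ → H, (Summable fun n => ‖ξ n‖ ^ 2) →
      Summable fun a : ℕ × ι => ‖V (ξ a.1) a.2‖ ^ 2 := by
    intro ξ hξ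
    refine (summable_prod_of_nonneg fun _ => by positivity).2
      ⟨fun n => HilbertMultiple.summable_sq_norm (V (ξ n)), ?_⟩
    simp only [HilbertMultiple.tsum_sq_norm]
    refine Summable.of_nonneg_of_le (fun _ => by positivity) (fun n => ?_) (hξ.mul_left (‖V‖ ^ 2))
    rw [← mul_pow]
    exact pow_le_pow_left₀ (norm_nonneg _) (V.le_opNorm _) 2
  have key : ∀ (ξ η : ℕ → H), (Summable fun n => ‖ξ n‖ ^ 2) → (Summable fun n => ‖η n‖ ^ 2) →
      @Continuous N₁ ℂ N₁.ultraweakTopology _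
        fun x => ∑' n, ⟪η n, (Φ x : H →L[ℂ] H) (ξ n)⟫_ℂ := by
    intro ξ η hξ hη
    have h4 : (fun x : N₁ => ∑' n, ⟪η n, (Φ x : H →L[ℂ] H) (ξ n)⟫_ℂ)
        = fun x : N₁ => ∑' a : ℕ × ι, ⟪V (η a.1) a.2, (x : H →L[ℂ] H) (V (ξ a.1) a.2)⟫_ℂ := by
      funext x
      rw [((x : H →L[ℂ] H).summable_inner_of_summable_sq (hV ξ hξ) (hV η hη)).tsum_prod]
      refine tsum_congr fun n => ?_
      rw [hΦ, ContinuousLinearMap.comp_apply, ContinuousLinearMap.adjoint_inner_right,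
        lp.inner_eq_tsum]
      rfl
    rw [h4]
    exact N₁.continuous_tsum_inner (hV ξ hξ) (hV η hη)
  exact continuous_iInf_rng.2 fun ξ => continuous_iInf_rng.2 fun η => continuous_iInf_rng.2
    fun hξ => continuous_iInf_rng.2 fun hη => continuous_induced_rng.2 (key ξ η hξ hη)

/-- A normal map is determined by its values on a subspace with the bicommutant property. -/
theorem IsNormalMap.ext_of_eqOn {N : VonNeumannAlgebra H} {Ψ₁ Ψ₂ : N →ₗ[ℂ] N}
    (h₁ : IsNormalMap N N Ψ₁) (h₂ : IsNormalMap N N Ψ₂)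
    {S : Set (H →L[ℂ] H)} (hS : ∀ a ∈ S, star a ∈ S) (A : Submodule ℂ (H →L[ℂ] H)) (hone : 1 ∈ A)
    (hmul : ∀ a ∈ S, ∀ b ∈ A, a * b ∈ A) (hA : ∀ a ∈ A, a ∈ N)
    (hN : ∀ x ∈ N, ∀ y, (∀ a ∈ S, Commute y a) → Commute y x)
    (h : ∀ x : N, (x : H →L[ℂ] H) ∈ A → Ψ₁ x = Ψ₂ x) : Ψ₁ = Ψ₂ := by
  -- The `σ`-strong topology, which is finer than the `σ`-weak topology.
  let G : N → HilbertMultiple ℕ H → HilbertMultiple ℕ H := fun x ξ => amplify ℕ (x : H →L[ℂ] H) ξ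
  let τ : TopologicalSpace N := TopologicalSpace.induced G inferInstance
  have hτ : τ ≤ N.ultraweakTopology := by
    have h2 : 0 < (2 : ℝ≥0∞).toReal := by norm_num
    have hmem : ∀ ξ : ℕ → H, (Summable fun n => ‖ξ n‖ ^ 2) → Memℓp ξ 2 := fun ξ hξ =>
      (memℓp_gen_iff h2).2 (by simpa using hξ)
    refine le_iInf fun ξ => le_iInf fun η => le_iInf fun hξ => le_iInf fun hη => ?_
    rw [← continuous_iff_le_induced]
    let ξ' : HilbertMultiple ℕ H := ⟨ξ, hmem ξ hξ⟩
    let η' : HilbertMultiple ℕ H := ⟨η, hmem η hη⟩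
    have h3 : (fun x : N => ∑' n, ⟪η n, (x : H →L[ℂ] H) (ξ n)⟫_ℂ) = fun x => ⟪η', G x ξ'⟫_ℂ := by
      funext x
      rw [lp.inner_eq_tsum]
      rfl
    rw [h3]
    exact Continuous.inner continuous_const ((continuous_apply ξ').comp continuous_induced_dom)
  refine LinearMap.ext fun x => Subtype.ext (ContinuousLinearMap.ext fun ξ => ?_)
  refine ext_inner_left ℂ fun η => ?_
  have hcont : ∀ Ψ : N →ₗ[ℂ] N, IsNormalMap N N Ψ →
      @Continuous N ℂ τ _ fun x => ⟪η, (Ψ x : H →L[ℂ] H) ξ⟫_ℂ := fun Ψ hΨ =>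
    continuous_le_dom hτ (@Continuous.comp N N ℂ N.ultraweakTopology N.ultraweakTopology _ _ _
      (N.continuous_inner ξ η) hΨ)
  have hclosed := @isClosed_eq _ _ _ τ _ _ _ (hcont Ψ₁ h₁) (hcont Ψ₂ h₂)
  have hsub : {x : N | (x : H →L[ℂ] H) ∈ A} ⊆
      {x : N | ⟪η, (Ψ₁ x : H →L[ℂ] H) ξ⟫_ℂ = ⟪η, (Ψ₂ x : H →L[ℂ] H) ξ⟫_ℂ} := fun y hy => by
    show ⟪η, (Ψ₁ y : H →L[ℂ] H) ξ⟫_ℂ = ⟪η, (Ψ₂ y : H →L[ℂ] H) ξ⟫_ℂ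
    rw [h y hy]
  refine (@IsClosed.closure_subset_iff _ τ _ _ hclosed).2 hsub ?_
  rw [closure_induced, mem_closure_iff]
  intro U hU hxU
  obtain ⟨I, u, hu, hIU⟩ := isOpen_pi_iff.1 hU _ hxU
  have hev : ∀ᶠ ε : ℝ in nhdsWithin 0 (Set.Ioi 0), ∀ ζ ∈ I, Metric.ball (G x ζ) ε ⊆ u ζ := by
    rw [Filter.eventually_all_finset]
    intro ζ hζ
    obtain ⟨δ, hδ, hball⟩ := Metric.isOpen_iff.1 (hu ζ hζ).1 _ (hu ζ hζ).2
    filter_upwards [nhdsWithin_le_nhds (eventually_lt_nhds hδ)] with ε hε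
    exact (Metric.ball_subset_ball hε.le).trans hball
  obtain ⟨ε, hε, hεpos⟩ := (hev.and self_mem_nhdsWithin).exists
  obtain ⟨a, ha, hlt⟩ := exists_forall_norm_amplify_sub_lt hS A hone hmul (hN x x.2) I hεpos
  refine ⟨G ⟨a, hA a ha⟩, hIU fun ζ hζ => hε ζ hζ ?_, ⟨⟨a, hA a ha⟩, ha, rfl⟩⟩
  rw [Metric.mem_ball, dist_comm, dist_eq_norm]
  exact hlt ζ hζ

end VonNeumannAlgebra

/-! ### Complete positivity of compressions -/

section CStarAlgebra

variable {A : Type*} [NonUnitalCStarAlgebra A] [PartialOrder A] [StarOrderedRing A]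

/-- For `m` the negative part of `a` one has `m a m = -m³`, and `m³` is the square of `b = √m m`. -/
theorem IsSelfAdjoint.exists_mul_mul_eq_neg {a : A} (ha : IsSelfAdjoint a) :
    ∃ m b : A, IsSelfAdjoint m ∧ m * a * m = -(star b * b) ∧ (b = 0 → 0 ≤ a) := by
  set m : A := a⁻ with hm
  have hm0 : 0 ≤ m := CFC.negPart_nonneg a
  have hmsa : star m = m := hm0.isSelfAdjoint.star_eq
  have h1 : m * a * m = -(m * m * m) := by
    have h2 : a = a⁺ - m := (CFC.posPart_sub_negPart a ha).symm
    have h3 : m * a = -(m * m) := by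
      conv_lhs => rw [h2, mul_sub, hm, CFC.negPart_mul_posPart, zero_sub]
    rw [h3, neg_mul]
  have h4 : star (CFC.sqrt m * m) * (CFC.sqrt m * m) = m * m * m := by
    rw [star_mul, hmsa, (CFC.sqrt_nonneg m).isSelfAdjoint.star_eq]
    calc m * CFC.sqrt m * (CFC.sqrt m * m) = m * (CFC.sqrt m * CFC.sqrt m) * m := by
          simp only [mul_assoc]
      _ = m * m * m := by rw [CFC.sqrt_mul_sqrt_self m hm0]
  refine ⟨m, CFC.sqrt m * m, hmsa, h1.trans (by rw [h4]), fun h5 => ?_⟩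
  rw [h5, mul_zero] at h4
  have h11 : m * m = 0 := by
    refine (CStarRing.star_mul_self_eq_zero_iff _).1 ?_
    rw [star_mul, hmsa, ← mul_assoc, ← h4, zero_mul]
  have h12 : m = 0 := by
    refine (CStarRing.star_mul_self_eq_zero_iff _).1 ?_
    rw [hmsa, h11]
  exact (CFC.negPart_eq_zero_iff a ha).1 h12

/-- A self-adjoint matrix `M` over a C⋆-algebra is positive if `∑ xᵢ⋆ Mᵢⱼ xⱼ ≥ 0` for all
columns `x`: applied to the columns of the negative part `m` of `M`, the hypothesis says that the
diagonal entries of `m M m = -m³` are positive. -/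
theorem CStarMatrix.nonneg_of_forall_sum_nonneg {n : Type*} [Fintype n] {M : CStarMatrix n n A}
    (hM : IsSelfAdjoint M) (h : ∀ x : n → A, 0 ≤ ∑ i, ∑ j, star (x i) * M i j * x j) : 0 ≤ M := by
  obtain ⟨m, b, hm, h1, hb⟩ := hM.exists_mul_mul_eq_neg
  refine hb (CStarMatrix.ext fun i k => ?_)
  have h6 : 0 ≤ (m * M * m) k k := by
    have h7 := h fun j => m j k
    have h8 : ∀ i, star (m i k) = m k i := fun i => by
      rw [← CStarMatrix.star_apply, hm.star_eq]
    simp only [h8] at h7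
    rw [CStarMatrix.mul_apply]
    simp only [CStarMatrix.mul_apply, Finset.sum_mul]
    rwa [Finset.sum_comm]
  rw [h1, CStarMatrix.neg_apply, CStarMatrix.mul_apply] at h6
  simp only [CStarMatrix.star_apply] at h6
  have h9 : ∀ i ∈ Finset.univ, 0 ≤ star (b i k) * b i k := fun i _ => star_mul_self_nonneg _
  have h10 : ∑ i, star (b i k) * b i k = 0 :=
    le_antisymm (neg_nonneg.1 h6) (Finset.sum_nonneg h9)
  exact (CStarRing.star_mul_self_eq_zero_iff _).1
    ((Finset.sum_eq_zero_iff_of_nonneg h9).1 h10 i (Finset.mem_univ i))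

/-- One direction of `CStarAlgebra.nonneg_iff_eq_star_mul_self`, in a form that applies to algebras
of matrices without the instances of the functional calculus there. -/
theorem exists_eq_star_mul_self_of_nonneg {a : A} (ha : 0 ≤ a) : ∃ b : A, a = star b * b :=
  CStarAlgebra.nonneg_iff_eq_star_mul_self.1 ha

end CStarAlgebra

namespace VonNeumannAlgebra

variable {H : Type*} [NormedAddCommGroup H] [InnerProductSpace ℂ H] [CompleteSpace H]

/-- The compression `x ↦ V* (x ⊗ 1) V` of an amplification, as a completely positive map: a
positive matrix is of the form `m⋆ m`, and the sums `∑ xᵢ⋆ V* (m⋆ m)ᵢⱼ V xⱼ` are sums of the squares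
of `∑ mₗᵢ V xᵢ`. -/
def compression {ι : Type*} {N₁ N₂ : VonNeumannAlgebra H} (V : H →L[ℂ] HilbertMultiple ι H)
    (hV : ∀ x ∈ N₁, ContinuousLinearMap.adjoint V ∘L amplify ι x ∘L V ∈ N₂) : N₁ →CP N₂ where
  toFun x := ⟨_, hV x x.2⟩
  map_add' x y := Subtype.ext (by
    show ContinuousLinearMap.adjoint V ∘L amplify ι ((x : H →L[ℂ] H) + y) ∘L V = _ + _
    rw [amplify_add, ContinuousLinearMap.add_comp, ContinuousLinearMap.comp_add])
  map_smul' a x := Subtype.ext (by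
    show ContinuousLinearMap.adjoint V ∘L amplify ι (a • (x : H →L[ℂ] H)) ∘L V = a • _
    rw [amplify_smul, ContinuousLinearMap.smul_comp, ContinuousLinearMap.comp_smul])
  map_cstarMatrix_nonneg' k M hM := by
    have hstar : ∀ x : N₁, star (⟨_, hV x x.2⟩ : N₂) = ⟨_, hV _ (star x).2⟩ := fun x =>
      Subtype.ext (by
        show star (ContinuousLinearMap.adjoint V ∘L amplify ι (x : H →L[ℂ] H) ∘L V)
          = ContinuousLinearMap.adjoint V ∘L amplify ι (star (x : H →L[ℂ] H)) ∘L V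
        rw [amplify_star, ContinuousLinearMap.star_eq_adjoint, ContinuousLinearMap.star_eq_adjoint,
          ContinuousLinearMap.adjoint_comp, ContinuousLinearMap.adjoint_comp,
          ContinuousLinearMap.adjoint_adjoint, ContinuousLinearMap.comp_assoc])
    obtain ⟨m, rfl⟩ := exists_eq_star_mul_self_of_nonneg hM
    refine CStarMatrix.nonneg_of_forall_sum_nonneg ?_ fun x => ?_
    · refine CStarMatrix.ext fun i j => ?_
      rw [CStarMatrix.star_apply, CStarMatrix.map_apply, CStarMatrix.map_apply]
      refine (hstar _).trans ?_
      have h1 : star ((star m * m) j i) = (star m * m) i j := by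
        rw [← CStarMatrix.star_apply, star_mul, star_star]
      exact congrArg (fun y : N₁ => (⟨_, hV y y.2⟩ : N₂)) h1
    · show (0 : H →L[ℂ] H) ≤ _
      have h1 : ((∑ i, ∑ j, star (x i) * (star m * m).map (fun y : N₁ =>
            (⟨_, hV y y.2⟩ : N₂)) i j * x j : N₂) : H →L[ℂ] H)
          = ∑ l, ContinuousLinearMap.adjoint
              (∑ i, amplify ι (m l i : H →L[ℂ] H) ∘L V ∘L (x i : H →L[ℂ] H))
              ∘L (∑ i, amplify ι (m l i : H →L[ℂ] H) ∘L V ∘L (x i : H →L[ℂ] H)) := by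
        have hterm : ∀ i j, ((star (x i) * (star m * m).map (fun y : N₁ =>
            (⟨_, hV y y.2⟩ : N₂)) i j * x j : N₂) : H →L[ℂ] H)
            = ∑ l, ContinuousLinearMap.adjoint
                (amplify ι (m l i : H →L[ℂ] H) ∘L V ∘L (x i : H →L[ℂ] H))
              ∘L (amplify ι (m l j : H →L[ℂ] H) ∘L V ∘L (x j : H →L[ℂ] H)) := by
          intro i j
          have h2 : amplify ι (((star m * m) i j : N₁) : H →L[ℂ] H)
              = ∑ l, star (amplify ι (m l i : H →L[ℂ] H)) * amplify ι (m l j : H →L[ℂ] H) := by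
            let F : N₁ →+ (HilbertMultiple ι H →L[ℂ] HilbertMultiple ι H) :=
              { toFun := fun y => amplify ι (y : H →L[ℂ] H)
                map_zero' := rfl
                map_add' := fun y z => amplify_add _ _ }
            have h3 : F ((star m * m) i j) = ∑ l, F (star m i l * m l j) := by
              rw [CStarMatrix.mul_apply, map_sum]
            refine h3.trans (Finset.sum_congr rfl fun l _ => ?_)
            rw [CStarMatrix.star_apply]
            show amplify ι (star (m l i : H →L[ℂ] H) * (m l j : H →L[ℂ] H)) = _
            rw [amplify_mul, amplify_star]
          show star (x i : H →L[ℂ] H) ∘L (ContinuousLinearMap.adjoint V ∘L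
            amplify ι (((star m * m) i j : N₁) : H →L[ℂ] H) ∘L V) ∘L (x j : H →L[ℂ] H) = _
          rw [h2]
          ext f
          simp only [ContinuousLinearMap.comp_apply, sum_apply, map_sum,
            ContinuousLinearMap.adjoint_comp, ContinuousLinearMap.star_eq_adjoint,
            mul_apply_eq_comp]
        simp only [AddSubmonoidClass.coe_finsetSum, hterm]
        rw [Finset.sum_congr rfl fun i _ => Finset.sum_comm, Finset.sum_comm]
        refine Finset.sum_congr rfl fun l _ => ?_
        ext f
        simp only [ContinuousLinearMap.comp_apply, sum_apply, map_sum]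
        exact Finset.sum_comm
      refine le_of_le_of_eq ?_ h1.symm
      refine Finset.sum_nonneg fun l _ => ?_
      rw [ContinuousLinearMap.nonneg_iff_isPositive]
      exact ContinuousLinearMap.isPositive_adjoint_comp_self _

theorem coe_compression {ι : Type*} {N₁ N₂ : VonNeumannAlgebra H}
    (V : H →L[ℂ] HilbertMultiple ι H)
    (hV : ∀ x ∈ N₁, ContinuousLinearMap.adjoint V ∘L amplify ι x ∘L V ∈ N₂) (x : N₁) :
    (compression V hV x : H →L[ℂ] H)
      = ContinuousLinearMap.adjoint V ∘L amplify ι (x : H →L[ℂ] H) ∘L V := rfl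

end VonNeumannAlgebra

/-! ### The dilation -/

namespace CoxeterSystem

open EllTwo

variable {B W W' : Type*} [Group W] [Group W'] {M : CoxeterMatrix B} (cs : CoxeterSystem M W)
  (cs' : CoxeterSystem M.double W')

theorem leftOp_delta_of_isLeftDescent (p : B → ℝ) {s : B} {w : W} (h : cs.IsLeftDescent w s) :
    cs.leftOp p s (delta w) = delta (cs.simple s * w) + (p s : ℂ) • delta w := by
  have h1 := cs.leftOp_delta_of_not_isLeftDescent p
    (cs.isLeftDescent_iff_not_isLeftDescent_mul.1 h)
  rw [cs.simple_mul_simple_cancel_left] at h1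
  have h2 := congrFun (congrArg DFunLike.coe (cs.leftOp_mul_self p s)) (delta (cs.simple s * w))
  change cs.leftOp p s (cs.leftOp p s (delta (cs.simple s * w)))
    = delta (cs.simple s * w) + (p s : ℂ) • cs.leftOp p s (delta (cs.simple s * w)) at h2
  rwa [h1] at h2

/-- The space `ℓ²(W')` of the doubled system is, over the subalgebra of the generators
`(s, false)`, contained in a multiple of `ℓ²(W)`: each coset `W g`, with `g` of minimal length,
carries a copy of the standard representation. -/
theorem exists_isometry_intertwining_leftOp (hM : M.IsRightAngled) (p : ℝ) :
    ∃ Θ : EllTwo W' →ₗᵢ[ℂ] HilbertMultiple W' (EllTwo W), ∀ s,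
      Θ.toContinuousLinearMap ∘L cs'.leftOp (doubleParam p) (s, false)
        = amplify W' (cs.leftOp (fun _ => p) s) ∘L Θ.toContinuousLinearMap := by
  classical
  obtain ⟨g, hg, hmin⟩ := cs.exists_minimal_coset_representative cs' hM
  choose u hu hmin using hmin
  have hus : ∀ s x, u (cs'.simple (s, false) * x) = cs.simple s * u x := by
    intro s x
    have h1 := hu (cs'.simple (s, false) * x)
    rw [← cs.toDouble_simple cs' hM, hg] at h1
    conv_lhs at h1 => rw [hu x, ← mul_assoc, ← map_mul]
    rw [← cs.toDouble_simple cs' hM]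
    exact (cs.toDouble_injective cs' hM (mul_right_cancel h1)).symm
  have hgs : ∀ s x, g (cs'.simple (s, false) * x) = g x := by
    intro s x
    rw [← cs.toDouble_simple cs' hM, hg]
  have hinj : ∀ x y, g x = g y → u x = u y → x = y := by
    intro x y h1 h2
    rw [hu x, hu y, h1, h2]
  have horth : Orthonormal ℂ fun x : W' =>
      (lp.single 2 (g x) (delta (u x)) : HilbertMultiple W' (EllTwo W)) := by
    rw [orthonormal_iff_ite]
    intro x y
    rw [lp.inner_single_left, lp.single_apply]
    by_cases h1 : g x = g y
    · rw [h1, Pi.single_eq_same, inner_delta_left, delta_apply]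
      by_cases h2 : u x = u y
      · rw [if_pos h2, if_pos (hinj x y h1 h2)]
      · rw [if_neg h2, if_neg fun h => h2 (by rw [h])]
    · rw [Pi.single_eq_of_ne h1, inner_zero_right, if_neg fun h => h1 (by rw [h])]
  refine ⟨horth.isometry, fun s => continuousLinearMap_ext fun x => ?_⟩
  have hdesc : cs'.IsLeftDescent x (s, false) ↔ cs.IsLeftDescent (u x) s := by
    rw [← cs.isLeftDescent_toDouble_mul_iff cs' hM (hmin x) (u x) s, ← hu x]
  show horth.isometry (cs'.leftOp (doubleParam p) (s, false) (delta x))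
    = amplify W' (cs.leftOp (fun _ => p) s) (horth.isometry (delta x))
  rw [horth.isometry_delta, amplify_single]
  by_cases h : cs.IsLeftDescent (u x) s
  · rw [cs'.leftOp_delta_of_isLeftDescent _ (hdesc.2 h), cs.leftOp_delta_of_isLeftDescent _ h,
      map_add, map_smul, horth.isometry_delta, horth.isometry_delta, hgs, hus, lp.single_add,
      lp.single_smul]
    rfl
  · rw [cs'.leftOp_delta_of_not_isLeftDescent _ (fun h' => h (hdesc.1 h')),
      cs.leftOp_delta_of_not_isLeftDescent _ h, horth.isometry_delta, hgs, hus]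

theorem _root_.ContinuousLinearMap.commute_comp_comp_adjoint {H K : Type*} [NormedAddCommGroup H]
    [InnerProductSpace ℂ H] [CompleteSpace H] [NormedAddCommGroup K] [InnerProductSpace ℂ K]
    [CompleteSpace K] {Θ : H →L[ℂ] K} {a b : H →L[ℂ] H} {a' : K →L[ℂ] K}
    (ha : IsSelfAdjoint a) (ha' : IsSelfAdjoint a') (h : Θ ∘L a = a' ∘L Θ) (hab : Commute a b) :
    Commute (Θ ∘L b ∘L ContinuousLinearMap.adjoint Θ) a' := by
  have h1 : a ∘L ContinuousLinearMap.adjoint Θ = ContinuousLinearMap.adjoint Θ ∘L a' := by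
    have h2 := congrArg ContinuousLinearMap.adjoint h
    rwa [ContinuousLinearMap.adjoint_comp, ContinuousLinearMap.adjoint_comp,
      ← ContinuousLinearMap.star_eq_adjoint a, ← ContinuousLinearMap.star_eq_adjoint a',
      ha.star_eq, ha'.star_eq] at h2
  have h3 : a ∘L b = b ∘L a := hab.eq
  show (Θ ∘L b ∘L ContinuousLinearMap.adjoint Θ) ∘L a'
    = a' ∘L (Θ ∘L b ∘L ContinuousLinearMap.adjoint Θ)
  rw [ContinuousLinearMap.comp_assoc, ContinuousLinearMap.comp_assoc, ← h1,
    ← ContinuousLinearMap.comp_assoc a', ← h, ContinuousLinearMap.comp_assoc,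
    ← ContinuousLinearMap.comp_assoc a b, h3, ContinuousLinearMap.comp_assoc]

theorem toDouble_apply_prod_leftOp (hM : M.IsRightAngled) (p : ℝ) {ω : List B}
    (hω : cs.IsReduced ω) :
    (ω.map fun s => cs'.leftOp (doubleParam p) (s, false)).prod (delta 1)
      = delta (cs.toDouble cs' hM (cs.wordProd ω)) := by
  have h : cs'.IsReduced (ω.map fun s => (s, false)) := by
    unfold IsReduced
    rw [← cs.toDouble_wordProd cs' hM, length_toDouble, hω.eq, List.length_map]
  rw [cs.toDouble_wordProd cs' hM, ← cs'.prod_leftOp_delta_one (doubleParam p) h, List.map_map]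
  rfl

/-- The dilation of the radial multiplier: an isometry `V` whose compressions `V* (x ⊗ 1) V` of
elements of the Hecke algebra commute with the right Hecke operators, and for which
`V* (T_w ⊗ 1) V Ω = c^{2|w|} T_w Ω`. -/
theorem exists_isometry_adjoint_amplify (hM : M.IsRightAngled) (p : ℝ) {c d : ℝ}
    (hcd : c ^ 2 + d ^ 2 = 1) :
    ∃ V : EllTwo W →L[ℂ] HilbertMultiple M.double.Group (EllTwo W),
      ContinuousLinearMap.adjoint V ∘L V = 1 ∧
      (∀ x, (∀ y, (∀ s, Commute y (cs.leftOp (fun _ => p) s)) → Commute y x) → ∀ s,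
        Commute (ContinuousLinearMap.adjoint V ∘L amplify M.double.Group x ∘L V)
          (cs.rightOp (fun _ => p) s)) ∧
      ∀ ω, cs.IsReduced ω → (ContinuousLinearMap.adjoint V ∘L
        amplify M.double.Group (ω.map (cs.leftOp fun _ => p)).prod ∘L V) (delta 1)
          = ((c : ℂ) ^ 2) ^ ω.length • delta (cs.wordProd ω) := by
  let cs' := M.double.toCoxeterSystem
  obtain ⟨Θ₀, hΘ⟩ := cs.exists_isometry_intertwining_leftOp cs' hM p
  set Θ := Θ₀.toContinuousLinearMap with hΘdef
  have hΘ1 : ContinuousLinearMap.adjoint Θ ∘L Θ = 1 :=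
    (ContinuousLinearMap.norm_map_iff_adjoint_comp_self Θ).1 Θ₀.norm_map
  set U := cs.conjIsometry cs' p hM hcd with hU
  have hU1 : ContinuousLinearMap.adjoint U ∘L U = 1 :=
    (ContinuousLinearMap.norm_map_iff_adjoint_comp_self U).1
      (cs.orthonormal_conjVec cs' p hM hcd).isometry.norm_map
  have hΘapp : ∀ f, ContinuousLinearMap.adjoint Θ (Θ f) = f := fun f =>
    congrFun (congrArg DFunLike.coe hΘ1) f
  have hUapp : ∀ f, ContinuousLinearMap.adjoint U (U f) = f := fun f =>
    congrFun (congrArg DFunLike.coe hU1) f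
  refine ⟨Θ ∘L U, ?_, fun x hx s => ?_, fun ω hω => ?_⟩
  · ext1 f
    rw [ContinuousLinearMap.adjoint_comp]
    show ContinuousLinearMap.adjoint U (ContinuousLinearMap.adjoint Θ (Θ (U f))) = f
    rw [hΘapp, hUapp]
  · set a := cs.rightOp (fun _ => p) s with ha
    set a' := cs'.rightConjOp p c d s with ha'
    -- The operator `Θ a' Θ*` commutes with the amplified generators, hence with `x ⊗ 1`.
    have h1 : Commute (Θ ∘L a' ∘L ContinuousLinearMap.adjoint Θ) (amplify M.double.Group x) := by
      refine commute_amplify_of_bicommutant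
        (S := Set.range (cs.leftOp fun _ => p)) (fun y hy => hx y fun t => hy _ ⟨t, rfl⟩) ?_
      rintro _ ⟨t, rfl⟩
      refine ContinuousLinearMap.commute_comp_comp_adjoint (cs'.isSelfAdjoint_leftOp _ _) ?_
        (hΘ t) (cs'.commute_leftOp_rightConjOp p c d hM _ s)
      rw [IsSelfAdjoint, ← amplify_star, (cs.isSelfAdjoint_leftOp _ t).star_eq]
    have h2 : U ∘L a = a' ∘L U := cs.conjIsometry_rightOp cs' p hM hcd s
    have h3 : a ∘L ContinuousLinearMap.adjoint U = ContinuousLinearMap.adjoint U ∘L a' := by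
      have h2 := congrArg ContinuousLinearMap.adjoint h2
      rwa [ContinuousLinearMap.adjoint_comp, ContinuousLinearMap.adjoint_comp,
        ← ContinuousLinearMap.star_eq_adjoint a, ← ContinuousLinearMap.star_eq_adjoint a',
        (cs.isSelfAdjoint_rightOp _ s).star_eq, (cs'.isSelfAdjoint_rightConjOp p c d s).star_eq]
        at h2
    have h1' : ∀ f, Θ (a' (ContinuousLinearMap.adjoint Θ (amplify M.double.Group x f)))
        = amplify M.double.Group x (Θ (a' (ContinuousLinearMap.adjoint Θ f))) :=
      fun f => congrFun (congrArg DFunLike.coe h1.eq) f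
    have h2' : ∀ f, U (a f) = a' (U f) := fun f => congrFun (congrArg DFunLike.coe h2) f
    have h3' : ∀ f, a (ContinuousLinearMap.adjoint U f) = ContinuousLinearMap.adjoint U (a' f) :=
      fun f => congrFun (congrArg DFunLike.coe h3) f
    refine ContinuousLinearMap.ext fun f => ?_
    rw [ContinuousLinearMap.adjoint_comp]
    show ContinuousLinearMap.adjoint U (ContinuousLinearMap.adjoint Θ
        (amplify M.double.Group x (Θ (U (a f)))))
      = a (ContinuousLinearMap.adjoint U (ContinuousLinearMap.adjoint Θ
        (amplify M.double.Group x (Θ (U f)))))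
    have h4 := h1' (Θ (U f))
    rw [hΘapp] at h4
    rw [h3', h2', ← h4, hΘapp]
  · -- As `Θ` intertwines and `Θ* Θ = 1`, the compression of `T_w ⊗ 1` by `V = Θ U` is the one of
    -- the product of the operators of `(s, false)` by `U`.
    have h1 : ∀ ω : List B, ∀ f, amplify M.double.Group (ω.map (cs.leftOp fun _ => p)).prod (Θ f)
        = Θ ((ω.map fun s => cs'.leftOp (doubleParam p) (s, false)).prod f) := by
      intro ω
      induction ω with
      | nil => intro f; rfl
      | cons s ω ih =>
        intro f
        rw [List.map_cons, List.prod_cons, amplify_mul, List.map_cons, List.prod_cons]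
        show amplify M.double.Group (cs.leftOp (fun _ => p) s)
          (amplify M.double.Group (ω.map (cs.leftOp fun _ => p)).prod (Θ f)) = _
        rw [ih]
        exact (congrFun (congrArg DFunLike.coe (hΘ s)) _).symm
    rw [ContinuousLinearMap.adjoint_comp]
    show ContinuousLinearMap.adjoint U (ContinuousLinearMap.adjoint Θ
      (amplify M.double.Group (ω.map (cs.leftOp fun _ => p)).prod (Θ (U (delta 1))))) = _
    rw [h1, hΘapp, hU, conjIsometry_delta, conjVec_one _ _ _ _ _ hM,
      cs.toDouble_apply_prod_leftOp cs' hM p hω]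
    ext v
    rw [← inner_delta_left, ContinuousLinearMap.adjoint_inner_right, conjIsometry_delta,
      inner_delta_right, conjVec_toDouble, lp.coeFn_smul, Pi.smul_apply, delta_apply]
    by_cases h : v = cs.wordProd ω
    · subst h
      simp [hω.eq]
    · rw [if_neg h, if_neg fun h' => h h'.symm]
      simp

end CoxeterSystem

/-! ### The Hecke von Neumann algebra -/

namespace CoxeterSystem

open EllTwo VonNeumannAlgebra

variable {B W : Type*} [Group W] {M : CoxeterMatrix B} (cs : CoxeterSystem M W) (q : ℝ)

/-- The right Hecke operators, which generate the commutant of the Hecke von Neumann algebra. -/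
def rightHeckeOp (s : B) : EllTwo W →L[ℂ] EllTwo W := cs.rightOp (fun _ => (q - 1) / √q) s

theorem heckeOp_eq_leftOp : cs.heckeOp q = cs.leftOp fun _ => (q - 1) / √q := rfl

theorem isSelfAdjoint_heckeOp (s : B) : IsSelfAdjoint (cs.heckeOp q s) :=
  cs.isSelfAdjoint_leftOp (fun _ => (q - 1) / √q) s

theorem mem_heckeVN_iff_bicommutant {x : EllTwo W →L[ℂ] EllTwo W} :
    x ∈ cs.heckeVN q ↔ ∀ y, (∀ s, Commute y (cs.heckeOp q s)) → Commute y x := by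
  rw [heckeVN, mem_generatedBy_iff (by rintro _ ⟨s, rfl⟩; exact cs.isSelfAdjoint_heckeOp q s)]
  simp only [Set.forall_mem_range]

/-- The Hecke von Neumann algebra is the commutant of the right Hecke operators. -/
theorem mem_heckeVN_iff (hM : M.IsRightAngled) {x : EllTwo W →L[ℂ] EllTwo W} :
    x ∈ cs.heckeVN q ↔ ∀ s, Commute x (cs.rightHeckeOp q s) := by
  rw [mem_heckeVN_iff_bicommutant]
  refine ⟨fun h s => (h _ fun t => ?_).symm, fun h y hy => ?_⟩
  · exact (cs.commute_leftOp_rightOp _ hM t s).symm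
  · exact (cs.commute_of_commute_rightOp_of_commute_leftOp _ hM h hy).symm

variable {q}

/-- The vector `Ω = δ_e` is separating for `M_q`. -/
theorem eq_of_mem_heckeVN (hM : M.IsRightAngled) {x y : EllTwo W →L[ℂ] EllTwo W}
    (hx : x ∈ cs.heckeVN q) (hy : y ∈ cs.heckeVN q) (h : x (delta 1) = y (delta 1)) : x = y :=
  cs.eq_of_apply_delta_one _ ((cs.mem_heckeVN_iff q hM).1 hx) ((cs.mem_heckeVN_iff q hM).1 hy) h

variable (q)

theorem heckeOp_mem_heckeVN (s : B) : cs.heckeOp q s ∈ cs.heckeVN q :=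
  (cs.heckeT q s).2

theorem prod_heckeOp_mem_heckeVN (ω : List B) : (ω.map (cs.heckeOp q)).prod ∈ cs.heckeVN q := by
  refine list_prod_mem fun x hx => ?_
  obtain ⟨s, -, rfl⟩ := List.mem_map.1 hx
  exact cs.heckeOp_mem_heckeVN q s

theorem prod_heckeOp_delta_one {ω : List B} (hω : cs.IsReduced ω) :
    (ω.map (cs.heckeOp q)).prod (delta 1) = delta (cs.wordProd ω) :=
  cs.prod_leftOp_delta_one _ hω

theorem heckeOp_delta_one (s : B) : cs.heckeOp q s (delta 1) = delta (cs.simple s) := by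
  have := cs.leftOp_delta_of_not_isLeftDescent (fun _ => (q - 1) / √q)
    (cs.not_isLeftDescent_one s)
  rwa [mul_one] at this

theorem heckeTw_eq_prod (hM : M.IsRightAngled) {ω : List B} (hω : cs.IsReduced ω) :
    (cs.heckeTw q (cs.wordProd ω) : EllTwo W →L[ℂ] EllTwo W) = (ω.map (cs.heckeOp q)).prod := by
  refine cs.eq_of_mem_heckeVN hM (cs.heckeTw q _).2 (cs.prod_heckeOp_mem_heckeVN q ω) ?_
  rw [heckeTw_delta_one, prod_heckeOp_delta_one _ _ hω]

theorem one_mem_span_heckeTw (hM : M.IsRightAngled) :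
    1 ∈ Submodule.span ℂ (Set.range (cs.heckeTw q)) := by
  refine Submodule.subset_span ⟨1, Subtype.ext ?_⟩
  refine cs.eq_of_mem_heckeVN hM (cs.heckeTw q _).2 (one_mem (cs.heckeVN q)) ?_
  rw [heckeTw_delta_one]
  rfl

theorem heckeT_mul_mem_span_heckeTw (hM : M.IsRightAngled) (s : B) {x : cs.heckeVN q}
    (hx : x ∈ Submodule.span ℂ (Set.range (cs.heckeTw q))) :
    cs.heckeT q s * x ∈ Submodule.span ℂ (Set.range (cs.heckeTw q)) := by
  have hw : ∀ w, cs.heckeTw q w ∈ Submodule.span ℂ (Set.range (cs.heckeTw q)) := fun w =>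
    Submodule.subset_span ⟨w, rfl⟩
  induction hx using Submodule.span_induction with
  | mem x hx =>
    obtain ⟨w, rfl⟩ := hx
    have h1 : cs.heckeT q s * cs.heckeTw q w =
        cs.heckeTw q (cs.simple s * w) + (if cs.length w < cs.length (cs.simple s * w) then 0
          else (((q - 1) / √q : ℝ) : ℂ) • cs.heckeTw q w) := by
      refine Subtype.ext (cs.eq_of_mem_heckeVN hM (Subtype.prop _) (Subtype.prop _) ?_)
      show cs.heckeOp q s ((cs.heckeTw q w : EllTwo W →L[ℂ] EllTwo W) (delta 1))
        = (cs.heckeTw q (cs.simple s * w) : EllTwo W →L[ℂ] EllTwo W) (delta 1) + _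
      rw [heckeTw_delta_one, heckeTw_delta_one, heckeOp_delta]
      split_ifs
      · exact (add_zero _).symm
      · rw [← cs.heckeTw_delta_one q w]
        rfl
    rw [h1]
    refine Submodule.add_mem _ (hw _) ?_
    split_ifs
    · exact Submodule.zero_mem _
    · exact Submodule.smul_mem _ _ (hw _)
  | zero => rw [mul_zero]; exact Submodule.zero_mem _
  | add x y _ _ hx hy => rw [mul_add]; exact Submodule.add_mem _ hx hy
  | smul c x _ hx => rw [mul_smul_comm]; exact Submodule.smul_mem _ _ hx

/-- Normal maps on `M_q` which agree at all `T_w` are equal. -/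
theorem isNormalMap_ext (hM : M.IsRightAngled) {Ψ₁ Ψ₂ : cs.heckeVN q →ₗ[ℂ] cs.heckeVN q}
    (h₁ : IsNormalMap _ _ Ψ₁) (h₂ : IsNormalMap _ _ Ψ₂)
    (h : ∀ w, Ψ₁ (cs.heckeTw q w) = Ψ₂ (cs.heckeTw q w)) : Ψ₁ = Ψ₂ := by
  let incl : cs.heckeVN q →ₗ[ℂ] (EllTwo W →L[ℂ] EllTwo W) :=
    { toFun := Subtype.val, map_add' := fun _ _ => rfl, map_smul' := fun _ _ => rfl }
  refine h₁.ext_of_eqOn h₂ (S := Set.range (cs.heckeOp q)) ?_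
    ((Submodule.span ℂ (Set.range (cs.heckeTw q))).map incl)
    ⟨1, cs.one_mem_span_heckeTw q hM, rfl⟩ ?_ ?_ ?_ ?_
  · rintro _ ⟨s, rfl⟩
    exact ⟨s, (cs.isSelfAdjoint_heckeOp q s).star_eq.symm⟩
  · rintro _ ⟨s, rfl⟩ _ ⟨x, hx, rfl⟩
    exact ⟨_, cs.heckeT_mul_mem_span_heckeTw q hM s hx, rfl⟩
  · rintro _ ⟨x, -, rfl⟩
    exact x.2
  · intro x hx y hy
    exact (cs.mem_heckeVN_iff_bicommutant q).1 hx y fun s => hy _ ⟨s, rfl⟩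
  · rintro x ⟨y, hy, hyx⟩
    obtain rfl : y = x := Subtype.ext hyx
    exact LinearMap.eqOn_span (by rintro _ ⟨w, rfl⟩; exact h w) hy

/-! ### The vertex algebras -/

theorem vertexVN_subset (s : B) :
    (cs.vertexVN q s : Set (EllTwo W →L[ℂ] EllTwo W)) ⊆ cs.heckeVN q :=
  generatedBy_subset (by rintro _ ⟨t, -, rfl⟩; exact cs.heckeOp_mem_heckeVN q t)

theorem simple_ne_one (s : B) : cs.simple s ≠ 1 := fun h => by
  have := cs.length_simple s
  rw [h, cs.length_one] at this
  exact absurd this (by norm_num)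

/-- The elements of `M_q(s)` are `α + β T_s`: since they commute with the projection onto
`ℓ²({e, s})`, they map `Ω` into the span of `δ_e` and `δ_s`. -/
theorem eq_add_of_mem_vertexVN (hM : M.IsRightAngled) {s : B} {x : EllTwo W →L[ℂ] EllTwo W}
    (hx : x ∈ cs.vertexVN q s) :
    x = x (delta 1) 1 • 1 + x (delta 1) (cs.simple s) • cs.heckeOp q s := by
  classical
  have hsim := cs.simple_ne_one s
  have hcomm : Commute (restrict {1, cs.simple s}) (cs.heckeOp q s) := by
    have hmem : ∀ w, cs.simple s * w ∈ ({1, cs.simple s} : Set W) ↔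
        w ∈ ({1, cs.simple s} : Set W) := fun w => by
      simp only [Set.mem_insert_iff, Set.mem_singleton_iff, mul_eq_left]
      rw [or_comm, mul_eq_one_iff_eq_inv', cs.inv_simple]
    ext f w
    show (restrict {1, cs.simple s} (cs.heckeOp q s f)) w
      = cs.heckeOp q s (restrict {1, cs.simple s} f) w
    simp only [heckeOp_eq_leftOp, restrict_apply, leftOp_apply, Set.indicator_apply, hmem]
    split_ifs <;> simp
  have hx1 : Commute (restrict {1, cs.simple s}) x := by
    refine (mem_generatedBy_iff ?_).1 hx _ ?_
    · rintro _ ⟨t, -, rfl⟩; exact cs.isSelfAdjoint_heckeOp q t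
    · rintro _ ⟨t, rfl, rfl⟩; exact hcomm
  refine cs.eq_of_mem_heckeVN hM (cs.vertexVN_subset q s hx) ?_ ?_
  · exact add_mem (SMulMemClass.smul_mem _ (one_mem _))
      (SMulMemClass.smul_mem _ (cs.heckeOp_mem_heckeVN q s))
  · have h1 : restrict {1, cs.simple s} (delta (1 : W)) = delta 1 := by
      ext w
      rw [restrict_apply, Set.indicator_apply]
      split_ifs with h
      · rfl
      · exact (delta_of_ne fun h' => h (by simp [h'])).symm
    have h2 := ContinuousLinearMap.apply_apply_of_commute hx1 (delta 1)
    rw [h1] at h2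
    show x (delta 1)
      = x (delta 1) 1 • delta 1 + x (delta 1) (cs.simple s) • cs.heckeOp q s (delta 1)
    rw [heckeOp_delta_one]
    ext w
    rw [lp.coeFn_add, Pi.add_apply, lp.coeFn_smul, lp.coeFn_smul, Pi.smul_apply, Pi.smul_apply]
    conv_lhs => rw [← h2]
    rw [restrict_apply, Set.indicator_apply, delta_apply, delta_apply]
    by_cases hw1 : w = 1
    · subst hw1
      simp [hsim.symm]
    · by_cases hws : w = cs.simple s
      · subst hws
        simp [hsim]
      · simp [hw1, hws]

theorem inner_delta_one_heckeOp (s : B) :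
    ⟪(delta 1 : EllTwo W), cs.heckeOp q s (delta 1)⟫_ℂ = 0 := by
  rw [heckeOp_delta_one, inner_delta_left, delta_of_ne (cs.simple_ne_one s).symm]

theorem finrank_vertexVN (hM : M.IsRightAngled) (s : B) :
    Module.finrank ℂ (cs.vertexVN q s) = 2 := by
  have hli : LinearIndependent ℂ ![(1 : cs.vertexVN q s), cs.vertexT q s] := by
    rw [LinearIndependent.pair_iff]
    intro α β h
    have h1 : α • delta 1 + β • delta (cs.simple s) = (0 : EllTwo W) := by
      rw [← cs.heckeOp_delta_one q s]
      exact congrArg (fun x : cs.vertexVN q s => (x : EllTwo W →L[ℂ] EllTwo W) (delta 1)) h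
    have h2 : ∀ w : W, α * (delta 1 : EllTwo W) w + β * (delta (cs.simple s) : EllTwo W) w = 0 :=
      fun w => congrArg (fun f : EllTwo W => f w) h1
    have h3 := h2 1
    have h4 := h2 (cs.simple s)
    rw [delta_self, delta_of_ne (cs.simple_ne_one s).symm] at h3
    rw [delta_self, delta_of_ne (cs.simple_ne_one s)] at h4
    exact ⟨by simpa using h3, by simpa using h4⟩
  have hsp : ⊤ ≤ Submodule.span ℂ (Set.range ![(1 : cs.vertexVN q s), cs.vertexT q s]) := by
    rintro x -
    have h1 : x = (x : EllTwo W →L[ℂ] EllTwo W) (delta 1) 1 • 1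
        + (x : EllTwo W →L[ℂ] EllTwo W) (delta 1) (cs.simple s) • cs.vertexT q s :=
      Subtype.ext (cs.eq_add_of_mem_vertexVN q hM x.2)
    rw [h1]
    exact Submodule.add_mem _ (Submodule.smul_mem _ _ (Submodule.subset_span ⟨0, rfl⟩))
      (Submodule.smul_mem _ _ (Submodule.subset_span ⟨1, rfl⟩))
  rw [Module.finrank_eq_card_basis (Module.Basis.mk hli hsp), Fintype.card_fin]

/-- An element of `M_q(s)` of trace zero is a multiple of `T_s`. -/
theorem eq_smul_of_mem_vertexVN (hM : M.IsRightAngled) {s : B} {x : EllTwo W →L[ℂ] EllTwo W}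
    (hx : x ∈ cs.vertexVN q s) (h : ⟪delta 1, x (delta 1)⟫_ℂ = 0) :
    ∃ β : ℂ, x = β • cs.heckeOp q s := by
  rw [inner_delta_left] at h
  refine ⟨x (delta 1) (cs.simple s), ?_⟩
  conv_lhs => rw [cs.eq_add_of_mem_vertexVN q hM hx, h, zero_smul, zero_add]

/-- A product of elements of trace zero of vertex algebras is a multiple of the corresponding
product of Hecke operators. -/
theorem exists_prod_eq_smul (hM : M.IsRightAngled) (a : List (Σ s, cs.vertexVN q s))
    (h : ∀ x ∈ a, ⟪delta 1, (x.2 : EllTwo W →L[ℂ] EllTwo W) (delta 1)⟫_ℂ = 0) :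
    ∃ γ : ℂ, (a.map fun x => (x.2 : EllTwo W →L[ℂ] EllTwo W)).prod
      = γ • ((a.map Sigma.fst).map (cs.heckeOp q)).prod := by
  induction a with
  | nil => exact ⟨1, (one_smul _ _).symm⟩
  | cons x a ih =>
    obtain ⟨γ, hγ⟩ := ih fun y hy => h y (List.mem_cons_of_mem _ hy)
    obtain ⟨β, hβ⟩ := cs.eq_smul_of_mem_vertexVN q hM x.2.2 (h x List.mem_cons_self)
    refine ⟨β * γ, ?_⟩
    rw [List.map_cons, List.prod_cons, hγ, hβ, List.map_cons, List.map_cons, List.prod_cons,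
      smul_mul_smul_comm]

theorem isGraphProduct_heckeVN (hM : M.IsRightAngled) :
    cs.IsGraphProduct (cs.heckeVN q) (delta (1 : W)) (cs.vertexVN q) where
  norm_eq_one := norm_delta 1
  cyclic := by
    have h := Submodule.dense_iff_topologicalClosure_eq_top.2
      (topologicalClosure_span_delta (W := W))
    refine h.mono ?_
    let ev : cs.heckeVN q →ₗ[ℂ] EllTwo W :=
      { toFun := fun x => (x : EllTwo W →L[ℂ] EllTwo W) (delta 1)
        map_add' := fun _ _ => rfl
        map_smul' := fun _ _ => rfl }
    have h1 : Submodule.span ℂ (Set.range delta) ≤ LinearMap.range ev := by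
      rw [Submodule.span_le]
      rintro _ ⟨w, rfl⟩
      exact ⟨cs.heckeTw q w, cs.heckeTw_delta_one q w⟩
    exact h1
  -- Already `τ(x⋆ x) = 0` implies `x = 0`, as `Ω` is separating.
  faithful s x hx h := by
    refine cs.eq_of_mem_heckeVN hM (cs.vertexVN_subset q s hx) (zero_mem _) ?_
    have h1 : ⟪delta 1, star x (x (delta 1))⟫_ℂ = 0 := by
      have := h (star x) (star_mem hx) 1 (one_mem _)
      rwa [mul_one] at this
    rw [ContinuousLinearMap.star_eq_adjoint, ContinuousLinearMap.adjoint_inner_right,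
      inner_self_eq_zero] at h1
    exact h1
  generated := by
    refine SetLike.coe_injective (Set.Subset.antisymm (generatedBy_subset ?_)
      (generatedBy_subset ?_))
    · exact Set.iUnion_subset fun s => cs.vertexVN_subset q s
    · rintro _ ⟨s, rfl⟩
      exact subset_generatedBy _ (Set.mem_iUnion.2 ⟨s, (cs.vertexT q s).2⟩)
  commute s t _ hst x hx y hy := by
    have h1 : Commute (cs.heckeOp q s) (cs.heckeOp q t) :=
      cs.commute_leftOp (fun _ => (q - 1) / √q) hM hst
    rw [cs.eq_add_of_mem_vertexVN q hM hx, cs.eq_add_of_mem_vertexVN q hM hy]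
    refine Commute.add_left ((Commute.one_left _).smul_left _) (Commute.smul_left ?_ _)
    exact Commute.add_right ((Commute.one_right _).smul_right _) (h1.smul_right _)
  independent a ha hred h := by
    obtain ⟨γ, hγ⟩ := cs.exists_prod_eq_smul q hM a h
    rw [hγ, smul_apply, prod_heckeOp_delta_one _ _ hred, inner_smul_right,
      inner_delta_left, delta_of_ne, mul_zero]
    intro h1
    have h2 := hred.eq
    rw [← h1, cs.length_one, List.length_map] at h2
    exact ha (List.length_eq_zero_iff.1 h2.symm)

/-! ### The radial multipliers -/

/-- The isometry `V` whose compression `x ↦ V* (x ⊗ 1) V` is the radial multiplier. -/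
theorem exists_isometry_radial (hM : M.IsRightAngled) {r : ℝ} (hr0 : 0 ≤ r) (hr1 : r ≤ 1) :
    ∃ V : EllTwo W →L[ℂ] HilbertMultiple M.double.Group (EllTwo W),
      ContinuousLinearMap.adjoint V ∘L V = 1 ∧
      (∀ x ∈ cs.heckeVN q, ContinuousLinearMap.adjoint V ∘L amplify _ x ∘L V ∈ cs.heckeVN q) ∧
      ∀ ω, cs.IsReduced ω →
        ContinuousLinearMap.adjoint V ∘L amplify _ (ω.map (cs.heckeOp q)).prod ∘L V
          = (r : ℂ) ^ ω.length • (ω.map (cs.heckeOp q)).prod := by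
  have hcd : √r ^ 2 + √(1 - r) ^ 2 = 1 := by
    rw [Real.sq_sqrt hr0, Real.sq_sqrt (sub_nonneg.2 hr1)]
    ring
  have hr : ((√r : ℝ) : ℂ) ^ 2 = r := by
    rw [← Complex.ofReal_pow, Real.sq_sqrt hr0]
  obtain ⟨V, hV1, hV2, hV3⟩ := cs.exists_isometry_adjoint_amplify hM ((q - 1) / √q) hcd
  have hmem : ∀ x ∈ cs.heckeVN q,
      ContinuousLinearMap.adjoint V ∘L amplify _ x ∘L V ∈ cs.heckeVN q := fun x hx =>
    (cs.mem_heckeVN_iff q hM).2 (hV2 x ((cs.mem_heckeVN_iff_bicommutant q).1 hx))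
  refine ⟨V, hV1, hmem, fun ω hω => ?_⟩
  have hprod := cs.prod_heckeOp_mem_heckeVN q ω
  refine cs.eq_of_mem_heckeVN hM (hmem _ hprod) (SMulMemClass.smul_mem _ hprod) ?_
  rw [hr] at hV3
  rw [smul_apply, cs.prod_heckeOp_delta_one q hω]
  exact hV3 ω hω

end CoxeterSystem

end

theorem mainTheorem7 {B W : Type*} [Group W] {M : CoxeterMatrix B} (cs : CoxeterSystem M W)
    (hM : M.IsRightAngled) (q : ℝ) (hq : 0 < q) (r : ℝ) (hr0 : 0 < r) (hr1 : r < 1) :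
    ∃ Φ : cs.heckeVN q →CP cs.heckeVN q,
      -- `Φ` is a normal ucp map with `Φ(T_w) = r^{|w|} T_w`
      VonNeumannAlgebra.IsNormalMap (cs.heckeVN q) (cs.heckeVN q) Φ.toLinearMap ∧
      Φ 1 = 1 ∧
      (∀ w : W, Φ (cs.heckeTw q w) = (r : ℂ) ^ cs.length w • cs.heckeTw q w) ∧
      -- it is determined by these values
      (∀ Ψ : cs.heckeVN q →ₗ[ℂ] cs.heckeVN q,
        VonNeumannAlgebra.IsNormalMap (cs.heckeVN q) (cs.heckeVN q) Ψ →
        (∀ w : W, Ψ (cs.heckeTw q w) = (r : ℂ) ^ cs.length w • cs.heckeTw q w) →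
        Ψ = Φ.toLinearMap) ∧
      -- `M_q` is the graph product of the two-dimensional algebras `M_q(s)`, and `Φ` is the graph
      -- product of the ucp maps on `M_q(s)` given by `1 ↦ 1`, `T_s ↦ r T_s`
      cs.IsGraphProduct (cs.heckeVN q) (EllTwo.delta (1 : W)) (cs.vertexVN q) ∧
      (∀ s : B, Module.finrank ℂ (cs.vertexVN q s) = 2) ∧
      ∃ φ : ∀ s : B, cs.vertexVN q s →CP cs.vertexVN q s,
        (∀ s : B, φ s 1 = 1) ∧
        (∀ s : B, φ s (cs.vertexT q s) = (r : ℂ) • cs.vertexT q s) ∧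
        cs.IsGraphProductMap (cs.heckeVN q) (EllTwo.delta (1 : W)) (cs.vertexVN q) Φ φ := by
  -- The global map and the vertex maps are compressions by the same isometry.
  obtain ⟨V, hV1, hVmem, hVprod⟩ := cs.exists_isometry_radial q hM hr0.le hr1.le
  have hVs : ∀ s, ContinuousLinearMap.adjoint V ∘L amplify _ (cs.heckeOp q s) ∘L V
      = (r : ℂ) • cs.heckeOp q s := fun s => by
    simpa using hVprod [s] (by simp [CoxeterSystem.IsReduced])
  have hVone : ContinuousLinearMap.adjoint V ∘L amplify _ 1 ∘L V = 1 := hV1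
  have hVadd : ∀ (s : B) (α β : ℂ), ContinuousLinearMap.adjoint V ∘L
      amplify _ (α • 1 + β • cs.heckeOp q s) ∘L V = α • 1 + (β * r) • cs.heckeOp q s := by
    intro s α β
    rw [amplify_add, amplify_smul, amplify_smul, ContinuousLinearMap.add_comp,
      ContinuousLinearMap.comp_add, ContinuousLinearMap.smul_comp, ContinuousLinearMap.smul_comp,
      ContinuousLinearMap.comp_smul, ContinuousLinearMap.comp_smul, hVone, hVs, smul_smul]
  have hvertex : ∀ s, ∀ x ∈ cs.vertexVN q s,
      ContinuousLinearMap.adjoint V ∘L amplify _ x ∘L V ∈ cs.vertexVN q s := by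
    intro s x hx
    rw [cs.eq_add_of_mem_vertexVN q hM hx, hVadd]
    exact add_mem (SMulMemClass.smul_mem _ (one_mem _))
      (SMulMemClass.smul_mem _ (cs.vertexT q s).2)
  have hTw : ∀ w, VonNeumannAlgebra.compression V hVmem (cs.heckeTw q w)
      = (r : ℂ) ^ cs.length w • cs.heckeTw q w := by
    intro w
    obtain ⟨ω, hω, rfl⟩ := cs.exists_isReduced w
    refine Subtype.ext ?_
    rw [VonNeumannAlgebra.coe_compression, cs.heckeTw_eq_prod q hM hω, hVprod ω hω, hω.eq,
      ← cs.heckeTw_eq_prod q hM hω]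
    rfl
  have hnormal :
      VonNeumannAlgebra.IsNormalMap _ _ (VonNeumannAlgebra.compression V hVmem).toLinearMap :=
    VonNeumannAlgebra.isNormalMap_of_eq_compression V _ fun _ => rfl
  refine ⟨VonNeumannAlgebra.compression V hVmem, hnormal, Subtype.ext hVone, hTw, fun Ψ hΨ h => ?_,
    cs.isGraphProduct_heckeVN q hM, cs.finrank_vertexVN q hM,
    fun s => VonNeumannAlgebra.compression V (hvertex s), fun s => Subtype.ext hVone,
    fun s => Subtype.ext (hVs s),
    ?_, ?_⟩
  · exact cs.isNormalMap_ext q hM hΨ hnormal fun w => (h w).trans (hTw w).symm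
  · intro s x
    rw [VonNeumannAlgebra.coe_compression]
    conv_lhs => rw [cs.eq_add_of_mem_vertexVN q hM x.2, hVadd]
    conv_rhs => rw [cs.eq_add_of_mem_vertexVN q hM x.2]
    simp only [add_apply, smul_apply, inner_add_right, inner_smul_right,
      CoxeterSystem.inner_delta_one_heckeOp,
      mul_zero]
  · intro a hred h x hx
    obtain ⟨γ, hγ⟩ := cs.exists_prod_eq_smul q hM a h
    have hφ : (a.map fun y => (VonNeumannAlgebra.compression V (hvertex y.1) y.2 :
          EllTwo W →L[ℂ] EllTwo W)).prod
        = (r : ℂ) ^ a.length • (a.map fun y => (y.2 : EllTwo W →L[ℂ] EllTwo W)).prod := by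
      clear hx hγ hred
      induction a with
      | nil => exact (one_smul _ _).symm
      | cons y a ih =>
        obtain ⟨β, hβ⟩ := cs.eq_smul_of_mem_vertexVN q hM y.2.2 (h y List.mem_cons_self)
        rw [List.map_cons, List.prod_cons, ih fun z hz => h z (List.mem_cons_of_mem _ hz),
          List.map_cons, List.prod_cons, List.length_cons, VonNeumannAlgebra.coe_compression, hβ,
          amplify_smul, ContinuousLinearMap.smul_comp, ContinuousLinearMap.comp_smul, hVs,
          smul_smul, smul_mul_smul_comm, smul_mul_assoc, smul_smul]
        congr 1
        ring
    rw [hφ, VonNeumannAlgebra.coe_compression, hx, hγ, amplify_smul, ContinuousLinearMap.smul_comp,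
      ContinuousLinearMap.comp_smul, hVprod _ hred, List.length_map, smul_comm]
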